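/- Conventions. All Banach spaces are over $\mathbb{K}=\mathbb{R}$ or $\mathbb{C}$. For a Banach space $X$, put $X^{(0)}=X$ and $X^{(r+1)}=(X^{(r)})^*$. The space $X$ is quasi-reflexive if the image of its canonical embedding into $X^{**}$ has finite codimension in $X^{**}$. For an equivalent norm $N$ on $X$ and $t\ge 0$, let $$\overline{\rho}_{N}(t)=\sup_{N(x)=1}\ \inf_{Y}\ \sup_{y\in Y,\ N(y)=1}\big(N(x+ty)-1\big),$$ where $Y$ runs through the closed finite-codimensional subspaces of $X$. For $p\in(1,\infty)$, the norm $N$ is $p$-AUS ($p$-asymptotically uniformly smooth) if there is $c>0$ such that $\overline{\rho}_{N}(t)\le ct^p$ for all $t\ge 0$. For $k\in\mathbb{N}=\{1,2,\dots\}$, let $[\mathbb{N}]^k$ be the set of $k$-element subsets of $\mathbb{N}$, listed increasingly as $\overline{n}=(n_1<\dots<n_k)$. Distinct $\overline{n},\overline{m}\in[\mathbb{N}]^k$ are adjacent if and only if $n_1\le m_1\le n_2\le\dots\le n_k\le m_k$ or $m_1\le n_1\le m_2\le\dots\le m_k\le n_k$, and $d^k_{K}$ denotes the shortest path distance of the graph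 so obtained (the Kalton interlaced graph). A family $(M_i)_{i\in I}$ of metric spaces equi-coarsely embeds into a metric space $N$ if there are $\rho,\omega\colon[0,\infty)\to[0,\infty)$ with $\lim_{t\to\infty}\rho(t)=\infty$ and maps $f_i\colon M_i\to N$ such that, for all $i\in I$ and $t\ge 0$, $$\rho(t)\le\inf\{d_N(f_i(x),f_i(y)) : d_{M_i}(x,y)\ge t\}\quad\text{and}\quad \sup\{d_N(f_i(x),f_i(y)) : d_{M_i}(x,y)\le t\}\le\omega(t),$$ where $\inf\emptyset=\infty$ and $\sup\emptyset=0$. Corollary. Let $X$ be a quasi-reflexive Banach space, let $p\in(1,\infty)$ and let $q$ be its conjugate exponent, $\frac1p+\frac1q=1$. Assume that $X$ admits an equivalent $p$-AUS norm and that $X^*$ admits an equivalent $q$-AUS norm. Then the family $([\mathbb{N}]^k,d^k_{K})_{k\in\mathbb{N}}$ does not equi-coarsely embed into $X$, nor does it equi-coarsely embed into any iterated dual $X^{(r)}$, $r\ge 0$, of $X$. -/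

import Mathlib

open Filter
open scoped NNReal ENNReal

universe u v w

/-! ### Coarse embeddings -/

/-- The compression modulus `ρ_f(t) = inf {d(f x, f y) : d(x, y) ≥ t}`, with `inf ∅ = ∞`. -/
noncomputable def compressionModulus {M : Type v} {N : Type w} [MetricSpace M] [MetricSpace N]
    (f : M → N) (t : ℝ≥0) : ℝ≥0∞ :=
  ⨅ (x : M) (y : M) (_ : t ≤ nndist x y), edist (f x) (f y)

/-- The expansion modulus `ω_f(t) = sup {d(f x, f y) : d(x, y) ≤ t}`, with `sup ∅ = 0`. -/
noncomputable def expansionModulus {M : Type v} {N : Type w} [MetricSpace M] [MetricSpace N]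
    (f : M → N) (t : ℝ≥0) : ℝ≥0∞ :=
  ⨆ (x : M) (y : M) (_ : nndist x y ≤ t), edist (f x) (f y)

/-- A family of metric spaces equi-coarsely embeds into `N`. The requirement `ω(t) < ∞`
is expressed by `ω` having values in `[0, ∞)`. -/
def EquiCoarselyEmbeds {ι : Type u} (M : ι → Type v) [∀ i, MetricSpace (M i)]
    (N : Type w) [MetricSpace N] : Prop :=
  ∃ (ρ ω : ℝ≥0 → ℝ≥0) (f : ∀ i, M i → N),
    Tendsto ρ atTop atTop ∧
    ∀ (i : ι) (t : ℝ≥0),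
      (ρ t : ℝ≥0∞) ≤ compressionModulus (f i) t ∧ expansionModulus (f i) t ≤ (ω t : ℝ≥0∞)

/-! ### The Kalton interlaced graphs -/

/-- The set `[ℕ]^k` of `k`-element subsets of `ℕ`, each one listed in increasing order:
the element `n` is `n 0 < n 1 < ⋯ < n (k - 1)`. -/
def KaltonVertex (k : ℕ) : Type := Fin k ↪o ℕ

/-- The chain of inequalities `n₁ ≤ m₁ ≤ n₂ ≤ m₂ ≤ ⋯ ≤ n_k ≤ m_k`. -/
def Interlaced {k : ℕ} (n m : Fin k ↪o ℕ) : Prop :=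
  (∀ i : Fin k, n i ≤ m i) ∧ ∀ i j : Fin k, (i : ℕ) + 1 = j → m i ≤ n j

/-- Kalton's graph on `[ℕ]^k`: two distinct vertices are adjacent when they interlace. -/
def kaltonGraph (k : ℕ) : SimpleGraph (KaltonVertex k) where
  Adj n m := n ≠ m ∧ (Interlaced n m ∨ Interlaced m n)
  symm := ⟨fun _ _ h => ⟨h.1.symm, h.2.symm⟩⟩
  loopless := ⟨fun _ h => h.1 rfl⟩

/-- The vertex `{L, L + 1, …, L + k - 1}`. -/
def kaltonBlock (k L : ℕ) : KaltonVertex k :=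
  OrderEmbedding.ofStrictMono (fun i : Fin k => L + (i : ℕ)) (fun _ _ h => Nat.add_lt_add_left h L)

/-- The first `j` entries of `m`, followed by entries of a block far to the right. -/
def kaltonMix {k : ℕ} (m : Fin k ↪o ℕ) (L : ℕ) (hL : ∀ i, m i < L) (j : ℕ) : Fin k ↪o ℕ :=
  OrderEmbedding.ofStrictMono (fun i : Fin k => if (i : ℕ) < j then m i else L + (i : ℕ)) (by
    intro a b hab
    have h1 : m a < m b := m.strictMono hab
    have h2 := hL a
    have h3 : (a : ℕ) < b := hab
    dsimp only
    split_ifs <;> omega)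

theorem kaltonMix_apply {k : ℕ} (m : Fin k ↪o ℕ) (L : ℕ) (hL : ∀ i, m i < L) (j : ℕ)
    (i : Fin k) : kaltonMix m L hL j i = if (i : ℕ) < j then m i else L + (i : ℕ) := rfl

theorem kaltonMix_reachable {k : ℕ} (m : Fin k ↪o ℕ) (L : ℕ) (hL : ∀ i, m i < L) (j : ℕ) :
    (kaltonGraph k).Reachable (kaltonBlock k L) (kaltonMix m L hL j) := by
  induction j with
  | zero =>
    have h : kaltonMix m L hL 0 = kaltonBlock k L := by
      apply RelEmbedding.ext
      intro i
      rw [kaltonMix_apply, if_neg (Nat.not_lt_zero _)]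
      rfl
    rw [h]
  | succ j ih =>
    refine ih.trans ?_
    by_cases h : (kaltonMix m L hL j : KaltonVertex k) = kaltonMix m L hL (j + 1)
    · exact h ▸ SimpleGraph.Reachable.refl _
    · refine SimpleGraph.Adj.reachable ⟨h, Or.inr ⟨?_, ?_⟩⟩
      · intro i
        have := hL i
        rw [kaltonMix_apply, kaltonMix_apply]
        split_ifs <;> omega
      · intro a b hab
        have h1 : m a < m b := m.strictMono (Fin.lt_def.2 (by omega))
        have := hL a
        rw [kaltonMix_apply, kaltonMix_apply]
        split_ifs <;> omega

theorem kaltonGraph_connected (k : ℕ) : (kaltonGraph k).Connected := by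
  have key : ∀ (m : Fin k ↪o ℕ) (L : ℕ), (∀ i, m i < L) →
      (kaltonGraph k).Reachable (kaltonBlock k L) m := by
    intro m L hL
    have h : kaltonMix m L hL k = m := by
      apply RelEmbedding.ext
      intro i
      rw [kaltonMix_apply, if_pos i.isLt]
    have h2 := kaltonMix_reachable m L hL k
    rwa [h] at h2
  refine (SimpleGraph.connected_iff _).2 ⟨?_, ⟨kaltonBlock k 0⟩⟩
  intro (m : Fin k ↪o ℕ) (n : Fin k ↪o ℕ)
  have hL : ∀ i, m i < (∑ i, (m i + n i)) + 1 ∧ n i < (∑ i, (m i + n i)) + 1 := by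
    intro i
    have := Finset.single_le_sum (f := fun i => m i + n i) (fun _ _ => Nat.zero_le _)
      (Finset.mem_univ i)
    omega
  exact (key m _ fun i => (hL i).1).symm.trans (key n _ fun i => (hL i).2)

/-- `[ℕ]^k` is a metric space for the shortest path distance of Kalton's graph. -/
noncomputable instance (k : ℕ) : MetricSpace (KaltonVertex k) where
  dist n m := ((kaltonGraph k).dist n m : ℝ)
  dist_self n := by simp
  dist_comm n m := by rw [SimpleGraph.dist_comm]
  dist_triangle a b c := by exact_mod_cast (kaltonGraph_connected k).dist_triangle
  eq_of_dist_eq_zero := by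
    intro a b h
    exact (kaltonGraph_connected k).dist_eq_zero_iff.1 (by exact_mod_cast h)

/-! ### Asymptotic uniform smoothness -/

section Banach

variable (𝕜 : Type) [RCLike 𝕜] (X : Type u) [NormedAddCommGroup X] [NormedSpace 𝕜 X]

variable {𝕜 X} in
/-- `N` is an equivalent norm on `X`. -/
def IsEquivalentNorm (N : Seminorm 𝕜 X) : Prop :=
  ∃ a b : ℝ, 0 < a ∧ 0 < b ∧ ∀ x : X, a * ‖x‖ ≤ N x ∧ N x ≤ b * ‖x‖

variable {𝕜 X} in
/-- The subspace `Y` of `X` has finite codimension. -/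
def HasFiniteCodimension (Y : Submodule 𝕜 X) : Prop :=
  FiniteDimensional 𝕜 (X ⧸ Y)

variable {𝕜 X} in
/-- The modulus of asymptotic uniform smoothness of `X` for the (equivalent) norm `N`,
`sup_{N x = 1} inf_Y sup_{y ∈ Y, N y = 1} (N (x + t y) - 1)`, where `Y` runs through the closed
subspaces of finite codimension (equivalent norms have the same closed subspaces). The values
are extended reals, so the suprema and infima are genuine; a supremum over an empty unit sphere
(possible only when `X` is finite-dimensional) is `-∞`. -/
noncomputable def ausModulus (N : Seminorm 𝕜 X) (t : ℝ) : EReal :=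
  ⨆ (x : X) (_ : N x = 1),
    ⨅ (Y : Submodule 𝕜 X) (_ : IsClosed (Y : Set X)) (_ : HasFiniteCodimension Y),
      ⨆ (y : X) (_ : y ∈ Y ∧ N y = 1), ((N (x + (t : 𝕜) • y) - 1 : ℝ) : EReal)

variable {𝕜 X} in
/-- The norm `N` is `p`-asymptotically uniformly smooth. -/
def IsPAUS (p : ℝ) (N : Seminorm 𝕜 X) : Prop :=
  ∃ c : ℝ, 0 < c ∧ ∀ t : ℝ, 0 ≤ t → ausModulus N t ≤ ((c * t ^ p : ℝ) : EReal)

/-- `X` admits an equivalent `p`-asymptotically uniformly smooth norm. -/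
def AdmitsEquivalentPAUSNorm (p : ℝ) : Prop :=
  ∃ N : Seminorm 𝕜 X, IsEquivalentNorm N ∧ IsPAUS p N

/-! ### Quasi-reflexivity and iterated duals -/

/-- The canonical image of `X` in its bidual has finite codimension. -/
def IsQuasiReflexive : Prop :=
  HasFiniteCodimension (𝕜 := 𝕜) (X := StrongDual 𝕜 (StrongDual 𝕜 X))
    (NormedSpace.inclusionInDoubleDual 𝕜 X).range

/-- A bundled normed space, used to iterate the formation of the dual. -/
structure BundledNormedSpace where
  carrier : Type u
  [group : NormedAddCommGroup carrier]
  [space : NormedSpace 𝕜 carrier]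

attribute [instance] BundledNormedSpace.group BundledNormedSpace.space

/-- The `r`-th dual of `X` as a bundled normed space. -/
noncomputable def iteratedDualBundle : ℕ → BundledNormedSpace.{u} 𝕜
  | 0 => ⟨X⟩
  | r + 1 => ⟨StrongDual 𝕜 (iteratedDualBundle r).carrier⟩

/-- The iterated dual `X^{(r)}`: `X^{(0)} = X` and `X^{(r+1)} = (X^{(r)})*`. -/
def IteratedDual (r : ℕ) : Type u := (iteratedDualBundle 𝕜 X r).carrier

noncomputable instance (r : ℕ) : NormedAddCommGroup (IteratedDual 𝕜 X r) :=
  (iteratedDualBundle 𝕜 X r).group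

noncomputable instance (r : ℕ) : NormedSpace 𝕜 (IteratedDual 𝕜 X r) :=
  (iteratedDualBundle 𝕜 X r).space

end Banach

/-!
Let `J : X → X**` be the canonical embedding, and let `f` be a map from Kalton's graph of height `k`
to `X` which is Lipschitz with a constant `ω` independent of `k`. Taking iterated weak* limits
in `X**` along a nonprincipal ultrafilter (`exists_weakStar_tree`) writes `f(n₁, …, n_k)` as a
constant plus a sum of increments `z(n₁, …, n_i)`, `i ≤ k`, each of which is weak* null in `n_i`.
On a suitable subtree (`exists_isTypicalSubtree`) the norm of `z(n₁, …, n_i)` is almost a number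
`τ i`, and, since `X**/J(X)` has finite dimension, the class of `z(n₁, …, n_i)` modulo `J(X)` is
almost constant on each level.

The smoothness of `X*` dualizes to lower `p`-estimates for weak* null sequences in `X**`
(`exists_dualNorm_lower_estimate`). Applied to the difference of `f` at two interlaced vertices,
whose norm is at most `ω`, they bound `∑ i, (τ i) ^ p` independently of `k`
(`IsTypicalSubtree.sum_le`). Hence, for large `k`, there are `l` consecutive levels on which
`τ i ≤ 1 / l`. Take two vertices which agree outside of these levels, and such that on them all
entries of the first vertex precede those of the second one; their distance in the graph is at
least `l`. In the difference of the values of `f`, all increments are close to `J(X)` up to a small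
total error: on the `l` levels because they are small, later because they come in differences of
two increments of the same level. So the upper `p`-estimates of `X` apply and bound the
norm of the difference by a multiple of `(∑ i, (τ i) ^ p) ^ (1 / p)` plus a constant
(`IsTypicalSubtree.exists_shifted_branches`). This bound is independent of `l`, so the
compression moduli cannot tend to infinity (`not_equiCoarselyEmbeds_of_hasUpperEstimate`).

The assumptions pass from `X` to `X*` with `p` and `q` exchanged (`HasSmoothDuality.dual`): the
bidual is the sum of `X` and a finite-dimensional space, so it inherits a `p`-AUS norm. By induction
the result holds for all iterated duals.
-/

open scoped Topology

/-! ### Upper estimates from asymptotic uniform smoothness -/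

section Smoothness

variable {𝕜 : Type} [RCLike 𝕜] {V : Type u} [NormedAddCommGroup V] [NormedSpace 𝕜 V]

/-- The infimum over subspaces in the modulus of asymptotic smoothness is attained up to `ε`. -/
theorem exists_subspace_of_isPAUS {N : Seminorm 𝕜 V} {t r ε : ℝ}
    (h : ausModulus N t ≤ (r : EReal)) {x : V} (hx : N x = 1) (hε : 0 < ε) :
    ∃ Y : Submodule 𝕜 V, IsClosed (Y : Set V) ∧ Y.CoFG ∧
      ∀ y ∈ Y, N y = 1 → N (x + (t : 𝕜) • y) ≤ 1 + r + ε := by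
  have h1 := (le_iSup₂ (f := fun (x : V) (_ : N x = 1) =>
    ⨅ (Y : Submodule 𝕜 V) (_ : IsClosed (Y : Set V)) (_ : HasFiniteCodimension Y),
      ⨆ (y : V) (_ : y ∈ Y ∧ N y = 1), ((N (x + (t : 𝕜) • y) - 1 : ℝ) : EReal)) x hx).trans h
  have h2 : (r : EReal) < ((r + ε : ℝ) : EReal) := EReal.coe_lt_coe_iff.2 (by linarith)
  have h3 := lt_of_le_of_lt h1 h2
  simp only [iInf_lt_iff] at h3
  obtain ⟨Y, hc, hf, hY⟩ := h3
  refine ⟨Y, hc, hf, fun y hy hy1 => ?_⟩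
  have h4 := (le_iSup₂ (f := fun (y : V) (_ : y ∈ Y ∧ N y = 1) =>
    ((N (x + (t : 𝕜) • y) - 1 : ℝ) : EReal)) y ⟨hy, hy1⟩).trans hY.le
  have h5 := EReal.coe_le_coe_iff.1 h4
  linarith

/-- The homogeneous form of `p`-asymptotic uniform smoothness: an upper `p`-estimate for adding to
a fixed vector any vector of a suitable closed subspace of finite codimension. -/
def HasUpperEstimate (p C : ℝ) (N : Seminorm 𝕜 V) : Prop :=
  ∀ (x : V) (t : ℝ), 0 < t → ∃ Y : Submodule 𝕜 V, IsClosed (Y : Set V) ∧ Y.CoFG ∧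
    ∀ y ∈ Y, N y ≤ t → N (x + y) ^ p ≤ N x ^ p + C * t ^ p

theorem IsPAUS.exists_hasUpperEstimate {N : Seminorm 𝕜 V} {p : ℝ} (hp : 1 < p)
    (h : IsPAUS p N) : ∃ C : ℝ, 0 < C ∧ HasUpperEstimate p C N := by
  obtain ⟨c, hc, h⟩ := h
  have hp0 : 0 < p := by linarith
  refine ⟨(2 + c) ^ p, by positivity, fun x t ht => ?_⟩
  have hx0 : 0 ≤ N x := apply_nonneg N x
  -- When `N x ≤ t` the triangle inequality is enough.
  rcases le_or_gt (N x) t with hxt | hxt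
  · refine ⟨⊤, isClosed_univ, inferInstance, fun y _ hy => ?_⟩
    have h1 : N (x + y) ≤ (2 + c) * t := by
      have := map_add_le_add N x y
      nlinarith
    calc N (x + y) ^ p ≤ ((2 + c) * t) ^ p :=
          Real.rpow_le_rpow (apply_nonneg _ _) h1 hp0.le
      _ = (2 + c) ^ p * t ^ p := Real.mul_rpow (by positivity) ht.le
      _ ≤ _ := le_add_of_nonneg_left (by positivity)
  set a := N x with ha
  have ha0 : 0 < a := ht.trans hxt
  have hna : ‖((a : ℝ) : 𝕜)‖ = a := by simp [abs_of_pos ha0]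
  have haK : ((a : ℝ) : 𝕜) ≠ 0 := by
    rw [← norm_ne_zero_iff, hna]; exact ha0.ne'
  set s := t / a with hs
  have hs0 : 0 < s := by positivity
  have hs1 : s < 1 := (div_lt_one ha0).2 hxt
  set x' : V := ((a : 𝕜)⁻¹) • x with hx'
  have hNx' : N x' = 1 := by
    rw [hx', map_smul_eq_mul, norm_inv, hna, ← ha, inv_mul_cancel₀ ha0.ne']
  have hsp : 0 < s ^ p := by positivity
  obtain ⟨Y, hYc, hYf, hY⟩ := exists_subspace_of_isPAUS (h s hs0.le) hNx' hsp
  refine ⟨Y, hYc, hYf, fun y hy hyt => ?_⟩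
  rcases eq_or_lt_of_le (apply_nonneg N y) with hy0 | hy0
  · have h1 : N (x + y) ≤ a := by
      have := map_add_le_add N x y
      linarith
    calc N (x + y) ^ p ≤ a ^ p := Real.rpow_le_rpow (apply_nonneg _ _) h1 hp0.le
      _ ≤ _ := le_add_of_nonneg_right (by positivity)
  set b := N y with hb
  have hnb : ‖((b : ℝ) : 𝕜)‖ = b := by simp [abs_of_pos hy0]
  have hbK : ((b : ℝ) : 𝕜) ≠ 0 := by
    rw [← norm_ne_zero_iff, hnb]; exact hy0.ne'
  set w : V := ((b : 𝕜)⁻¹) • y with hw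
  have hNw : N w = 1 := by
    rw [hw, map_smul_eq_mul, norm_inv, hnb, ← hb, inv_mul_cancel₀ hy0.ne']
  have h1 := hY w (Y.smul_mem _ hy) hNw
  set θ := b / t with hθ
  have hθ0 : 0 ≤ θ := by positivity
  have hθ1 : θ ≤ 1 := (div_le_one ht).2 hyt
  -- `x + y` is `a` times a convex combination of `x / a` and `x / a + s y / b`.
  have hdec : x + y = (a : 𝕜) • (((1 - θ : ℝ) : 𝕜) • x' + ((θ : ℝ) : 𝕜) • (x' + (s : 𝕜) • w)) := by
    have e1 : (a : 𝕜) • x' = x := by rw [hx', smul_smul, mul_inv_cancel₀ haK, one_smul]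
    have e2 : ((a * θ * s : ℝ) : 𝕜) • w = y := by
      have : a * θ * s = b := by rw [hθ, hs]; field_simp
      rw [this, hw, smul_smul, mul_inv_cancel₀ hbK, one_smul]
    calc x + y = (a : 𝕜) • x' + ((a * θ * s : ℝ) : 𝕜) • w := by rw [e1, e2]
      _ = _ := by push_cast; module
  have h2 : N (x + y) ≤ a * (1 + (c + 1) * s ^ p) := by
    rw [hdec, map_smul_eq_mul, hna]
    refine mul_le_mul_of_nonneg_left ?_ ha0.le
    refine (map_add_le_add N _ _).trans ?_
    rw [map_smul_eq_mul N _ x', map_smul_eq_mul N _ (x' + _), hNx', RCLike.norm_ofReal,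
      RCLike.norm_ofReal,
      abs_of_nonneg hθ0, abs_of_nonneg (by linarith : 0 ≤ 1 - θ)]
    nlinarith [mul_le_mul_of_nonneg_left h1 hθ0, mul_nonneg (by linarith : 0 ≤ 1 - θ)
      (by positivity : 0 ≤ (c + 1) * s ^ p)]
  have hsp1 : s ^ p ≤ 1 := Real.rpow_le_one hs0.le hs1.le hp0.le
  have h3 : (1 + (c + 1) * s ^ p) ^ p ≤ 1 + (2 + c) ^ p * s ^ p := by
    have hc2 : 2 + c ∈ Set.Ici (0 : ℝ) := Set.mem_Ici.2 (by linarith)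
    have := (convexOn_rpow hp.le).2 (Set.mem_Ici.2 zero_le_one) hc2
      (sub_nonneg.2 hsp1) hsp.le (sub_add_cancel _ _)
    simp only [smul_eq_mul, Real.one_rpow] at this
    have e : (1 - s ^ p) * 1 + s ^ p * (2 + c) = 1 + (c + 1) * s ^ p := by ring
    rw [e] at this
    nlinarith
  have h4 : a ^ p * s ^ p = t ^ p := by
    rw [← Real.mul_rpow ha0.le hs0.le, hs, mul_div_cancel₀ _ ha0.ne']
  calc N (x + y) ^ p ≤ (a * (1 + (c + 1) * s ^ p)) ^ p :=
        Real.rpow_le_rpow (apply_nonneg _ _) h2 hp0.le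
    _ = a ^ p * (1 + (c + 1) * s ^ p) ^ p := Real.mul_rpow ha0.le (by positivity)
    _ ≤ a ^ p * (1 + (2 + c) ^ p * s ^ p) := by gcongr
    _ = a ^ p + (2 + c) ^ p * (a ^ p * s ^ p) := by ring
    _ = _ := by rw [h4]

/-- Modulo a closed subspace of finite codimension, bounded sequences converge along
ultrafilters. -/
theorem exists_tendsto_quotient (U : Ultrafilter ℕ) {Y : Submodule 𝕜 V}
    [hYc : IsClosed (Y : Set V)] (hYf : Y.CoFG) {v : ℕ → V} {B : ℝ} (hv : ∀ n, ‖v n‖ ≤ B) :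
    ∃ l : V ⧸ Y, Tendsto (fun n => (Submodule.Quotient.mk (v n) : V ⧸ Y)) U (𝓝 l) := by
  have : FiniteDimensional 𝕜 (V ⧸ Y) := hYf
  have : ProperSpace (V ⧸ Y) := FiniteDimensional.proper_rclike 𝕜 _
  obtain ⟨l, -, hl⟩ := (isCompact_closedBall (0 : V ⧸ Y) B).ultrafilter_le_nhds
    (U.map fun n => (Submodule.Quotient.mk (v n) : V ⧸ Y)) (by
      rw [le_principal_iff]
      refine Eventually.of_forall (f := (U : Filter ℕ)) fun n => ?_
      simp only [mem_closedBall_zero_iff]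
      exact (Submodule.Quotient.norm_mk_le Y (v n)).trans (hv n))
  exact ⟨l, hl⟩

theorem exists_mem_of_norm_mk_lt {Y : Submodule 𝕜 V} {v : V} {δ : ℝ}
    (h : ‖(Submodule.Quotient.mk v : V ⧸ Y)‖ < δ) : ∃ y ∈ Y, ‖v - y‖ < δ := by
  obtain ⟨m, hm, hmn⟩ := Submodule.Quotient.norm_mk_lt
    (Submodule.Quotient.mk v : V ⧸ Y) (sub_pos.2 h)
  refine ⟨v - m, (Submodule.Quotient.eq Y).1 hm.symm, ?_⟩
  simpa using hmn

end Smoothness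

/-! ### Dual norms and weak* null sequences -/

section WeakStar

variable {𝕜 : Type} [RCLike 𝕜] {V : Type u} [NormedAddCommGroup V] [NormedSpace 𝕜 V]

/-- The norm on the dual of `V` which is dual to the norm `M` of `V`. -/
noncomputable def dualNorm (M : Seminorm 𝕜 V) (φ : StrongDual 𝕜 V) : ℝ :=
  ⨆ v : {v : V // M v ≤ 1}, ‖φ v‖

theorem dualNorm_nonneg (M : Seminorm 𝕜 V) (φ : StrongDual 𝕜 V) : 0 ≤ dualNorm M φ :=
  Real.iSup_nonneg fun _ => norm_nonneg _

theorem norm_apply_le_of_le {M : Seminorm 𝕜 V} {a : ℝ} (ha : 0 < a) (h : ∀ v, a * ‖v‖ ≤ M v)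
    (φ : StrongDual 𝕜 V) {v : V} (hv : M v ≤ 1) : ‖φ v‖ ≤ ‖φ‖ / a := by
  refine (φ.le_opNorm v).trans ?_
  rw [div_eq_mul_inv]
  refine mul_le_mul_of_nonneg_left ?_ (norm_nonneg _)
  rw [← one_div, le_div_iff₀ ha]
  linarith [h v]

theorem dualNorm_le {M : Seminorm 𝕜 V} {a : ℝ} (ha : 0 < a) (h : ∀ v, a * ‖v‖ ≤ M v)
    (φ : StrongDual 𝕜 V) : dualNorm M φ ≤ ‖φ‖ / a :=
  Real.iSup_le (fun v => norm_apply_le_of_le ha h φ v.2) (by positivity)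

theorem IsEquivalentNorm.norm_apply_le_dualNorm {M : Seminorm 𝕜 V} (hM : IsEquivalentNorm M)
    (φ : StrongDual 𝕜 V) {v : V} (hv : M v ≤ 1) : ‖φ v‖ ≤ dualNorm M φ := by
  obtain ⟨a, b, ha, -, h⟩ := hM
  have hb : BddAbove (Set.range fun v : {v : V // M v ≤ 1} => ‖φ v‖) :=
    ⟨‖φ‖ / a, by rintro _ ⟨v, rfl⟩; exact norm_apply_le_of_le ha (fun v => (h v).1) φ v.2⟩
  exact le_ciSup hb ⟨v, hv⟩

theorem exists_re_eq_norm (φ : StrongDual 𝕜 V) (v : V) :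
    ∃ c : 𝕜, ‖c‖ = 1 ∧ RCLike.re (φ (c • v)) = ‖φ v‖ := by
  obtain ⟨c, hc, h⟩ := RCLike.exists_norm_eq_mul_self (φ v)
  exact ⟨c, hc, by rw [map_smul, smul_eq_mul, ← h, RCLike.ofReal_re]⟩

theorem exists_lt_re_of_lt_dualNorm {M : Seminorm 𝕜 V} {φ : StrongDual 𝕜 V} {r : ℝ}
    (hr : r < dualNorm M φ) : ∃ v, M v ≤ 1 ∧ r < RCLike.re (φ v) := by
  have : Nonempty {v : V // M v ≤ 1} := ⟨⟨0, by simp⟩⟩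
  obtain ⟨⟨v, hv⟩, hrv⟩ := exists_lt_of_lt_ciSup hr
  obtain ⟨c, hc, h⟩ := exists_re_eq_norm φ v
  exact ⟨c • v, by rwa [map_smul_eq_mul, hc, one_mul], by rwa [h]⟩

variable {U : Ultrafilter ℕ}

/-- A bounded sequence of functionals has a weak* limit along every ultrafilter. -/
theorem exists_weakStar_limit (U : Ultrafilter ℕ) {g : ℕ → StrongDual 𝕜 V} {B : ℝ}
    (hg : ∀ n, ‖g n‖ ≤ B) :
    ∃ φ : StrongDual 𝕜 V, ‖φ‖ ≤ B ∧ ∀ v, Tendsto (fun n => g n v) U (𝓝 (φ v)) := by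
  obtain ⟨φ, hφ, h⟩ := (WeakDual.isCompact_closedBall (𝕜 := 𝕜) (0 : StrongDual 𝕜 V)
    B).ultrafilter_le_nhds (U.map fun n => StrongDual.toWeakDual (g n)) (by
      rw [le_principal_iff]
      refine Eventually.of_forall (f := (U : Filter ℕ)) fun n => ?_
      simpa using hg n)
  refine ⟨WeakDual.toStrongDual φ, by simpa using hφ, fun v => ?_⟩
  exact ((WeakDual.eval_continuous v).tendsto φ).comp h

/-- A weak* null sequence that is bounded below in norm almost attains half of that bound on
every closed subspace of finite codimension. -/
theorem eventually_exists_mem_re_ge {Y : Submodule 𝕜 V} (hYc : IsClosed (Y : Set V))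
    (hYf : Y.CoFG) {g : ℕ → StrongDual 𝕜 V} {G : ℝ} (hG : ∀ n, ‖g n‖ ≤ G)
    (hg : ∀ v, Tendsto (fun n => g n v) U (𝓝 0)) {t : ℝ} (ht0 : 0 ≤ t)
    (ht : ∀ᶠ n in U, t ≤ ‖g n‖) :
    ∀ᶠ n in U, ∃ y ∈ Y, ‖y‖ ≤ 3 ∧ t / 2 ≤ RCLike.re (g n y) := by
  rcases eq_or_lt_of_le ht0 with rfl | ht0
  · exact Eventually.of_forall fun n => ⟨0, Y.zero_mem, by simp, by simp⟩
  have hG0 : 0 ≤ G := (norm_nonneg _).trans (hG 0)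
  have h1 : ∀ n, ∃ v : V, ‖v‖ ≤ 1 ∧ (t ≤ ‖g n‖ → 3 / 4 * t ≤ ‖g n v‖) := by
    intro n
    by_cases h : t ≤ ‖g n‖
    · obtain ⟨v, hv, h⟩ := (g n).exists_lt_apply_of_lt_opNorm
        (show 3 / 4 * t < ‖g n‖ by linarith)
      exact ⟨v, hv.le, fun _ => h.le⟩
    · exact ⟨0, by simp, fun h' => absurd h' h⟩
  choose v hv1 hv using h1
  have := hYc
  obtain ⟨l, hl⟩ := exists_tendsto_quotient U (Y := Y) hYf hv1
  set δ := min 1 (t / (8 * (G + 1))) with hδ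
  have hδ0 : 0 < δ := by positivity
  have hδ1 : δ ≤ 1 := min_le_left _ _
  have hδG : G * δ ≤ t / 8 := by
    have : δ ≤ t / (8 * (G + 1)) := min_le_right _ _
    rw [le_div_iff₀ (by positivity)] at this
    nlinarith
  have hl2 := Metric.tendsto_nhds.1 hl (δ / 2) (by positivity)
  obtain ⟨m, hm⟩ := hl2.exists
  have hgm := Metric.tendsto_nhds.1 (hg (v m)) (t / 8) (by positivity)
  filter_upwards [hl2, hgm, ht] with n hn hgn htn
  have h2 : ‖(Submodule.Quotient.mk (v n - v m) : V ⧸ Y)‖ < δ := by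
    rw [Submodule.Quotient.mk_sub, ← dist_eq_norm]
    linarith [dist_triangle_right (Submodule.Quotient.mk (v n) : V ⧸ Y)
      (Submodule.Quotient.mk (v m)) l]
  obtain ⟨y, hy, hyn⟩ := exists_mem_of_norm_mk_lt h2
  have h3 : ‖y‖ ≤ 3 := by
    have e : y = v n - v m - (v n - v m - y) := by abel
    rw [e]
    linarith [norm_sub_le (v n - v m) (v n - v m - y), norm_sub_le (v n) (v m), hv1 n, hv1 m]
  have h4 : t / 2 ≤ ‖g n y‖ := by
    have e : g n (v n) = g n y + g n (v m) + g n (v n - v m - y) := by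
      simp only [map_sub]; ring
    have h5 := hv n htn
    rw [e] at h5
    have h6 : ‖g n (v n - v m - y)‖ ≤ G * δ :=
      ((g n).le_opNorm _).trans (mul_le_mul (hG n) hyn.le (norm_nonneg _) hG0)
    rw [dist_zero_right] at hgn
    linarith [norm_add_le (g n y + g n (v m)) (g n (v n - v m - y)),
      norm_add_le (g n y) (g n (v m))]
  obtain ⟨c, hc, h⟩ := exists_re_eq_norm (g n) y
  exact ⟨c • y, Y.smul_mem _ hy, by rwa [norm_smul, hc, one_mul], by rwa [h]⟩

/-- Equality case of Hölder's inequality for two terms. -/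
theorem exists_holder_eq {p q : ℝ} (hpq : p.HolderConjugate q) {A B : ℝ} (hA : 0 ≤ A)
    (hB : 0 ≤ B) : ∃ α β : ℝ, 0 ≤ α ∧ 0 ≤ β ∧ α ^ q + β ^ q ≤ 1 ∧
      A * α + B * β = (A ^ p + B ^ p) ^ (1 / p) := by
  lift A to ℝ≥0 using hA
  lift B to ℝ≥0 using hB
  obtain ⟨⟨g, hg, h⟩, -⟩ := NNReal.isGreatest_Lp (Finset.univ : Finset (Fin 2)) ![A, B] hpq
  simp only [Set.mem_ofPred_eq, Fin.sum_univ_two] at hg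
  simp only [Fin.sum_univ_two, Matrix.cons_val_zero, Matrix.cons_val_one] at h
  exact ⟨g 0, g 1, (g 0).2, (g 1).2, by exact_mod_cast hg, by exact_mod_cast h⟩

theorem HasUpperEstimate.exists_of_nonneg {N : Seminorm 𝕜 V} {p C : ℝ}
    (h : HasUpperEstimate p C N) (hp : 0 < p) (x : V) {t : ℝ} (ht : 0 ≤ t) :
    ∃ Y : Submodule 𝕜 V, IsClosed (Y : Set V) ∧ Y.CoFG ∧
      ∀ y ∈ Y, N y ≤ t → N (x + y) ^ p ≤ N x ^ p + C * t ^ p := by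
  rcases eq_or_lt_of_le ht with rfl | ht
  · refine ⟨⊤, isClosed_univ, inferInstance, fun y _ hy => ?_⟩
    rw [Real.zero_rpow hp.ne', mul_zero, add_zero]
    exact Real.rpow_le_rpow (apply_nonneg _ _)
      (by linarith [map_add_le_add N x y]) hp.le
  · exact h x t ht

/-- Duality between smoothness and convexity: if a norm on `V` has upper `q`-estimates, its dual
norm has lower `p`-estimates for adding a weak* null sequence to a fixed functional. -/
theorem exists_dualNorm_lower_estimate {M : Seminorm 𝕜 V} (hM : IsEquivalentNorm M) {p q C : ℝ}
    (hpq : p.HolderConjugate q) (hC : 0 < C) (h : HasUpperEstimate q C M) :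
    ∃ κ : ℝ, 0 < κ ∧ ∀ (U : Ultrafilter ℕ) (ψ : StrongDual 𝕜 V) (g : ℕ → StrongDual 𝕜 V)
      (G t η : ℝ), (∀ n, ‖g n‖ ≤ G) → (∀ v, Tendsto (fun n => g n v) U (𝓝 0)) → 0 ≤ t →
      (∀ᶠ n in U, t ≤ ‖g n‖) → 0 < η →
      ∀ᶠ n in U, dualNorm M ψ ^ p + κ * t ^ p - η ≤ dualNorm M (ψ + g n) ^ p := by
  have hM' := hM
  obtain ⟨a, b, ha, hb, hab⟩ := hM'
  have hp0 : 0 < p := hpq.pos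
  have hq0 : 0 < q := hpq.symm.pos
  set c := C ^ (1 / q) with hc
  have hc0 : 0 < c := by positivity
  have hcq : c ^ q = C := by
    rw [hc, ← Real.rpow_mul hC.le, one_div_mul_cancel hq0.ne', Real.rpow_one]
  refine ⟨(1 / (6 * b * c)) ^ p, by positivity, ?_⟩
  intro U ψ g G t η hG hg ht0 ht hη
  set A := dualNorm M ψ with hA
  have hA0 : 0 ≤ A := dualNorm_nonneg M ψ
  set B := 1 / (6 * b * c) * t with hB
  have hB0 : 0 ≤ B := by positivity
  have hBp : (1 / (6 * b * c)) ^ p * t ^ p = B ^ p := (Real.mul_rpow (by positivity) ht0).symm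
  rw [hBp]
  obtain ⟨α, β, hα, hβ, hαβ, hS⟩ := exists_holder_eq hpq hA0 hB0
  set S := (A ^ p + B ^ p) ^ (1 / p) with hSdef
  have hS0 : 0 ≤ S := by positivity
  have hSp : S ^ p = A ^ p + B ^ p := by
    rw [hSdef, ← Real.rpow_mul (by positivity), one_div_mul_cancel hp0.ne', Real.rpow_one]
  have key : ∀ ε : ℝ, 0 < ε → ∀ᶠ n in U, S - ε ≤ dualNorm M (ψ + g n) := by
    intro ε hε
    obtain ⟨v₀, hv₀, hv₀'⟩ := exists_lt_re_of_lt_dualNorm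
      (show A - ε / 2 < dualNorm M ψ by rw [← hA]; linarith)
    have hα1 : α ≤ 1 := by
      by_contra! hcon
      have := Real.one_lt_rpow hcon hq0
      have : 0 ≤ β ^ q := by positivity
      linarith
    set v : V := ((α : ℝ) : 𝕜) • v₀ with hv
    have hMv : M v ≤ α := by
      rw [hv, map_smul_eq_mul, RCLike.norm_ofReal, abs_of_nonneg hα]
      nlinarith
    have hψv : A * α - ε / 2 ≤ RCLike.re (ψ v) := by
      rw [hv, map_smul, smul_eq_mul, RCLike.re_ofReal_mul]
      nlinarith
    set s := β / c with hs
    have hs0 : 0 ≤ s := by positivity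
    have hCs : C * s ^ q = β ^ q := by
      rw [hs, Real.div_rpow hβ hc0.le, hcq]; field_simp
    obtain ⟨Y, hYc, hYf, hY⟩ := h.exists_of_nonneg hq0 v hs0
    -- On the kernel of `ψ` the correction to `v` does not change the value of `ψ`.
    have hZc : IsClosed ((Y ⊓ LinearMap.ker (ψ : V →ₗ[𝕜] 𝕜) : Submodule 𝕜 V) : Set V) :=
      hYc.inter ψ.isClosed_ker
    have hZf : (Y ⊓ LinearMap.ker (ψ : V →ₗ[𝕜] 𝕜)).CoFG :=
      hYf.inf (Submodule.CoFG.ker _)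
    filter_upwards [eventually_exists_mem_re_ge hZc hZf hG hg ht0 ht,
      Metric.tendsto_nhds.1 (hg v) (ε / 2) (by positivity)] with n hn hgv
    obtain ⟨y, ⟨hyY, hyψ⟩, hy3, hyt⟩ := hn
    have hyψ : ψ y = 0 := hyψ
    set r : ℝ := s / (3 * b) with hr
    have hr0 : 0 ≤ r := by positivity
    set u : V := ((r : ℝ) : 𝕜) • y with hu
    have hMu : M u ≤ s := by
      rw [hu, map_smul_eq_mul, RCLike.norm_ofReal, abs_of_nonneg hr0]
      calc r * M y ≤ r * (b * 3) := by
            gcongr; exact (hab y).2.trans (by gcongr)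
        _ = s := by rw [hr]; field_simp
    have hψu : ψ u = 0 := by rw [hu, map_smul, hyψ, smul_zero]
    have hgu : B * β ≤ RCLike.re (g n u) := by
      rw [hu, map_smul, smul_eq_mul, RCLike.re_ofReal_mul]
      calc B * β = r * (t / 2) := by rw [hB, hr, hs]; field_simp; ring
        _ ≤ _ := by gcongr
    have hle : M (v + u) ^ q ≤ 1 := by
      refine (hY u (Y.smul_mem _ hyY) hMu).trans ?_
      rw [hCs]
      have : M v ^ q ≤ α ^ q := Real.rpow_le_rpow (apply_nonneg _ _) hMv hq0.le
      linarith
    have hle1 : M (v + u) ≤ 1 := by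
      by_contra! hcon
      exact absurd hle (not_le.2 (Real.one_lt_rpow hcon hq0))
    have hgv' : -(ε / 2) ≤ RCLike.re (g n v) := by
      rw [dist_zero_right] at hgv
      have := RCLike.abs_re_le_norm (g n v)
      linarith [neg_abs_le (RCLike.re (g n v))]
    calc S - ε ≤ RCLike.re (ψ v) + RCLike.re (g n v) + RCLike.re (g n u) := by linarith
      _ = RCLike.re ((ψ + g n) (v + u)) := by
          rw [add_apply, map_add ψ, hψu, add_zero, map_add (g n),
            map_add RCLike.re, map_add RCLike.re]
          ring
      _ ≤ ‖(ψ + g n) (v + u)‖ := RCLike.re_le_norm _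
      _ ≤ _ := hM.norm_apply_le_dualNorm _ hle1
  have hcont : Tendsto (fun ε : ℝ => (max (S - ε) 0) ^ p) (𝓝[>] 0) (𝓝 (S ^ p)) := by
    have : Continuous fun ε : ℝ => (max (S - ε) 0) ^ p :=
      ((continuous_const.sub continuous_id).max continuous_const).rpow_const
        fun _ => Or.inr hp0.le
    have := this.tendsto 0
    simp only [sub_zero, max_eq_left hS0] at this
    exact this.mono_left nhdsWithin_le_nhds
  obtain ⟨ε, hε1, hε⟩ := ((hcont.eventually_const_le (show S ^ p - η < S ^ p by linarith)).and
    self_mem_nhdsWithin).exists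
  filter_upwards [key ε hε] with n hn
  rw [← hSp]
  exact hε1.trans (Real.rpow_le_rpow (le_max_right _ _) (max_le hn (dualNorm_nonneg _ _)) hp0.le)

end WeakStar

/-! ### Upper estimates for weak* null sequences close to a subspace -/

section Embedding

variable {𝕜 : Type} [RCLike 𝕜] {X : Type u} [NormedAddCommGroup X] [NormedSpace 𝕜 X]
  {V : Type v} [NormedAddCommGroup V] [NormedSpace 𝕜 V]

/-- The isometric embedding `J` of `X` into the dual of `V` identifies `V` with a space of
functionals on `X` containing all bounded functionals, as the canonical embedding into the bidual
does. -/
def RepresentsDual (J : X →ₗᵢ[𝕜] StrongDual 𝕜 V) : Prop :=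
  ∀ φ : StrongDual 𝕜 X, ∃ v : V, ‖v‖ ≤ ‖φ‖ ∧ ∀ x, J x v = φ x

/-- Upper `p`-estimates pass to weak* null sequences that are close to the
image of `X`: up to a controlled error, the terms of such a sequence can be replaced by vectors
of `X` for which the estimate holds. -/
theorem eventually_exists_upper_estimate {U : Ultrafilter ℕ} {N : Seminorm 𝕜 X} {p C b : ℝ}
    {J : X →ₗᵢ[𝕜] StrongDual 𝕜 V} (hJV : RepresentsDual J) (hb : 0 < b)
    (hN : ∀ x, N x ≤ b * ‖x‖) (h : HasUpperEstimate p C N) (x : X)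
    {g : ℕ → StrongDual 𝕜 V} (hg : ∀ φ, Tendsto (fun n => g n φ) U (𝓝 0))
    {t δ : ℝ} (ht0 : 0 ≤ t) (hδ : 0 < δ) (ht : ∀ᶠ n in U, ‖g n‖ ≤ t)
    (hgδ : ∀ᶠ n in U, ∃ z, ‖g n - J z‖ < δ) :
    ∀ᶠ n in U, ∃ y, ‖g n - J y‖ ≤ 3 * δ ∧
      N (x + y) ^ p ≤ N x ^ p + C * b ^ p * (t + 3 * δ) ^ p := by
  have hJ : ∀ z : X, ‖J z‖ = ‖z‖ := J.norm_map
  have h1 : ∀ n, ∃ z : X, ‖z‖ ≤ t + δ ∧ ((‖g n‖ ≤ t ∧ ∃ z, ‖g n - J z‖ < δ) →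
      ‖g n - J z‖ < δ) := by
    intro n
    by_cases hc : ‖g n‖ ≤ t ∧ ∃ z, ‖g n - J z‖ < δ
    · obtain ⟨hc, z, hz⟩ := hc
      refine ⟨z, ?_, fun _ => hz⟩
      rw [← hJ z]
      linarith [norm_le_norm_add_norm_sub (g n) (J z)]
    · exact ⟨0, by simp; positivity, fun h' => absurd h' hc⟩
  choose z hz hzδ using h1
  have hzδ' : ∀ᶠ n in U, ‖g n - J (z n)‖ < δ := by
    filter_upwards [ht, hgδ] with n h1 h2 using hzδ n ⟨h1, h2⟩
  obtain ⟨Y, hYc, hYf, hY⟩ := h x (b * (t + 3 * δ)) (by positivity)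
  have := hYc
  obtain ⟨l, hl⟩ := exists_tendsto_quotient U (Y := Y) hYf hz
  have hlδ : ‖l‖ ≤ δ := by
    refine NormedSpace.norm_le_dual_bound 𝕜 l hδ.le fun f => ?_
    let φ : StrongDual 𝕜 X := LinearMap.mkContinuous ((f : (X ⧸ Y) →ₗ[𝕜] 𝕜).comp Y.mkQ) ‖f‖
      fun w => (f.le_opNorm _).trans
        (mul_le_mul_of_nonneg_left (Submodule.Quotient.norm_mk_le Y w) (norm_nonneg _))
    have hφ : ‖φ‖ ≤ ‖f‖ := LinearMap.mkContinuous_norm_le _ (norm_nonneg _) _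
    have hφz : ∀ w, φ w = f (Submodule.Quotient.mk w) := fun _ => rfl
    obtain ⟨v, hv, hvφ⟩ := hJV φ
    have h2 : Tendsto (fun n => ‖f (Submodule.Quotient.mk (z n))‖) U (𝓝 ‖f l‖) :=
      ((f.continuous.tendsto l).comp hl).norm
    have h3 : Tendsto (fun n => ‖g n v‖ + δ * ‖f‖) U (𝓝 (0 + δ * ‖f‖)) :=
      (tendsto_zero_iff_norm_tendsto_zero.1 (hg v)).add_const _
    rw [zero_add] at h3
    refine le_of_tendsto_of_tendsto h2 h3 ?_
    filter_upwards [hzδ'] with n hn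
    have e : f (Submodule.Quotient.mk (z n)) = g n v - (g n - J (z n)) v := by
      rw [sub_apply, hvφ, hφz]; ring
    rw [e]
    refine (norm_sub_le _ _).trans (add_le_add_right ?_ _)
    exact ((g n - J (z n)).le_opNorm v).trans
      (mul_le_mul hn.le (hv.trans hφ) (norm_nonneg _) hδ.le)
  have h4 : ∀ᶠ n in U, ‖(Submodule.Quotient.mk (z n) : X ⧸ Y)‖ < 2 * δ :=
    hl.norm.eventually_lt_const (by linarith)
  filter_upwards [h4, hzδ', ht] with n h4 h5 h6
  obtain ⟨y, hy, hyn⟩ := exists_mem_of_norm_mk_lt h4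
  have h7 : ‖g n - J y‖ ≤ 3 * δ := by
    have e : g n - J y = (g n - J (z n)) + J (z n - y) := by rw [map_sub]; abel
    rw [e]
    refine (norm_add_le (g n - J (z n)) (J (z n - y))).trans ?_
    rw [hJ]
    linarith
  refine ⟨y, h7, ?_⟩
  have h8 : ‖y‖ ≤ t + 3 * δ := by
    rw [← hJ y]
    linarith [norm_le_norm_add_norm_sub (g n) (J y)]
  have h9 := hY y hy ((hN y).trans (by gcongr))
  rwa [Real.mul_rpow hb.le (by positivity), ← mul_assoc] at h9

end Embedding

/-! ### Trees of iterated limits -/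

section Trees

open Function

/-- A bounded function on sequences, regarded as attached to the nodes of level `k` of a tree,
extends to the lower levels by taking weak* limits along `U` in the last coordinate. The value at
a node of level `i` depends on the node `s` only through its coordinates before `i`, of which
independence of coordinate `i` is recorded. -/
theorem exists_weakStar_tree {𝕜 : Type} [RCLike 𝕜] {V : Type u} [NormedAddCommGroup V]
    [NormedSpace 𝕜 V] (U : Ultrafilter ℕ) {B : ℝ} (k : ℕ) (F : (ℕ → ℕ) → StrongDual 𝕜 V)
    (hF : ∀ s, ‖F s‖ ≤ B) :
    ∃ Φ : ℕ → (ℕ → ℕ) → StrongDual 𝕜 V, Φ k = F ∧ (∀ i s, ‖Φ i s‖ ≤ B) ∧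
      ∀ i < k, ∀ s,
        (∀ v, Tendsto (fun a => Φ (i + 1) (update s i a) v) U (𝓝 (Φ i s v))) ∧
        ∀ b, Φ i (update s i b) = Φ i s := by
  induction k generalizing F with
  | zero => exact ⟨fun _ => F, rfl, fun _ => hF, fun i hi => absurd hi (Nat.not_lt_zero i)⟩
  | succ k ih =>
    choose L hLB hL using fun g : {g : ℕ → StrongDual 𝕜 V // ∀ n, ‖g n‖ ≤ B} =>
      exists_weakStar_limit U g.2
    obtain ⟨Φ, hΦk, hΦB, hΦ⟩ := ih (fun s => L ⟨fun a => F (update s k a), fun _ => hF _⟩)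
      fun _ => hLB _
    refine ⟨fun i => if i ≤ k then Φ i else F, by simp, fun i s => ?_, fun i hi s => ?_⟩
    · dsimp only
      split_ifs
      exacts [hΦB i s, hF s]
    · rcases Nat.lt_succ_iff_lt_or_eq.1 hi with hi | rfl
      · simpa only [if_pos hi.le, if_pos (Nat.succ_le_of_lt hi)] using hΦ i hi s
      · simp only [le_refl, if_true, if_neg (Nat.not_succ_le_self i), hΦk, update_idem]
        exact ⟨hL ⟨fun a => F (update s i a), fun _ => hF _⟩, fun _ => trivial⟩

variable {E : Type v} [PseudoMetricSpace E] [Nonempty E]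

/-- The limit of `D` over the nodes that lie `j` levels above a node `s` of level `i`, taken
successively in each of the `j` coordinates. -/
noncomputable def iteratedLimit (U : Ultrafilter ℕ) (D : ℕ → (ℕ → ℕ) → E) :
    ℕ → ℕ → (ℕ → ℕ) → E
  | 0, i, s => D i s
  | j + 1, i, s => limUnder (U : Filter ℕ) fun a => iteratedLimit U D j (i + 1) (update s i a)

theorem iteratedLimit_mem_and_tendsto (U : Ultrafilter ℕ) {D : ℕ → (ℕ → ℕ) → E} {K : Set E}
    (hK : IsCompact K) (hKc : IsClosed K) (hD : ∀ i s, D i s ∈ K) (j : ℕ) : ∀ i s,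
      iteratedLimit U D j i s ∈ K ∧
      Tendsto (fun a => iteratedLimit U D j (i + 1) (update s i a)) U
        (𝓝 (iteratedLimit U D (j + 1) i s)) := by
  have key : ∀ j, (∀ i s, iteratedLimit U D j i s ∈ K) → ∀ i s,
      Tendsto (fun a => iteratedLimit U D j (i + 1) (update s i a)) U
        (𝓝 (iteratedLimit U D (j + 1) i s)) := by
    intro j hj i s
    obtain ⟨l, -, hl⟩ := hK.ultrafilter_le_nhds
      (U.map fun a => iteratedLimit U D j (i + 1) (update s i a)) (by
        rw [le_principal_iff]
        exact Eventually.of_forall (f := (U : Filter ℕ)) fun a => hj _ _)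
    exact tendsto_nhds_limUnder ⟨l, hl⟩
  induction j with
  | zero => exact fun i s => ⟨hD i s, key 0 hD i s⟩
  | succ j ih =>
    have h : ∀ i s, iteratedLimit U D (j + 1) i s ∈ K := fun i s =>
      hKc.mem_of_tendsto (ih i s).2 (Eventually.of_forall fun a => (ih _ _).1)
    exact fun i s => ⟨h i s, key (j + 1) h i s⟩

/-- A function on a tree with relatively compact range is almost constant on each level, up to
restricting to a subtree in which every node has `U`-almost all successors. -/
theorem exists_typical_subtree (U : Ultrafilter ℕ) {D : ℕ → (ℕ → ℕ) → E} {K : Set E}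
    (hK : IsCompact K) (hKc : IsClosed K) (hD : ∀ i s, D i s ∈ K) :
    ∃ d : ℕ → E, ∀ (k : ℕ) (ε : ℝ), 0 < ε → ∃ A : ℕ → (ℕ → ℕ) → Prop, A 0 0 ∧
      (∀ i < k, ∀ s, A i s → ∀ᶠ a in U, A (i + 1) (update s i a)) ∧
      ∀ i ≤ k, ∀ s, A i s → dist (D i s) (d i) < ε := by
  refine ⟨fun j => iteratedLimit U D j 0 0, fun k ε hε => ?_⟩
  refine ⟨fun i s => ∀ j ≤ k - i,
    dist (iteratedLimit U D j i s) (iteratedLimit U D (i + j) 0 0) < ε, ?_, ?_, ?_⟩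
  · intro j _
    simpa using hε
  · intro i hi s hs
    have : ∀ j ∈ Set.Iic (k - (i + 1)), ∀ᶠ a in (U : Filter ℕ),
        dist (iteratedLimit U D j (i + 1) (update s i a))
          (iteratedLimit U D (i + 1 + j) 0 0) < ε := by
      intro j hj
      have h1 := hs (j + 1) (by have := Set.mem_Iic.1 hj; omega)
      have h2 := ((iteratedLimit_mem_and_tendsto U hK hKc hD j i s).2.dist
        (tendsto_const_nhds (x := iteratedLimit U D (i + 1 + j) 0 0)))
      rw [show i + (j + 1) = i + 1 + j by omega] at h1
      exact h2.eventually_lt_const h1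
    exact (eventually_all_finite (Set.finite_Iic _)).2 this
  · intro i _ s hs
    exact hs 0 (Nat.zero_le _)

end Trees

/-! ### Distances in Kalton's graphs -/

section KaltonGraph

variable {k : ℕ}

/-- A vertex of Kalton's graph as an increasing enumeration of its elements. -/
def KaltonVertex.enum (m : KaltonVertex k) : Fin k ↪o ℕ := m

theorem kaltonGraph_dist_le_one {m n : KaltonVertex k} (h : Interlaced m.enum n.enum) :
    (kaltonGraph k).dist m n ≤ 1 := by
  by_cases hmn : m = n
  · rw [hmn, SimpleGraph.dist_self]
    exact zero_le_one
  · exact (SimpleGraph.dist_eq_one_iff_adj.2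
      (show (kaltonGraph k).Adj m n from ⟨hmn, Or.inl h⟩)).le

theorem kaltonGraph_dist_block_mix (m : Fin k ↪o ℕ) (L : ℕ) (hL : ∀ i, m i < L) (j : ℕ) :
    ∀ v : KaltonVertex k, v.enum = kaltonMix m L hL j →
      (kaltonGraph k).dist (kaltonBlock k L) v ≤ j := by
  induction j with
  | zero =>
    intro v hv
    have h : kaltonBlock k L = v := by
      refine Eq.trans ?_ hv.symm
      apply RelEmbedding.ext
      intro i
      rw [kaltonMix_apply, if_neg (Nat.not_lt_zero _)]
      rfl
    rw [h, SimpleGraph.dist_self]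
  | succ j ih =>
    intro v hv
    let w : KaltonVertex k := kaltonMix m L hL j
    have hw : w.enum = kaltonMix m L hL j := rfl
    have h1 := (kaltonGraph_connected k).dist_triangle (u := kaltonBlock k L) (v := w) (w := v)
    have h2 := ih w hw
    have h3 : (kaltonGraph k).dist v w ≤ 1 := by
      refine kaltonGraph_dist_le_one ⟨fun i => ?_, fun a b hab => ?_⟩
      · have := hL i
        rw [hv, hw, kaltonMix_apply, kaltonMix_apply]
        split_ifs <;> omega
      · have h1 : m a < m b := m.strictMono (Fin.lt_def.2 (by omega))
        have := hL a
        rw [hv, hw, kaltonMix_apply, kaltonMix_apply]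
        split_ifs <;> omega
    rw [SimpleGraph.dist_comm] at h3
    omega

theorem kaltonGraph_dist_le (m n : KaltonVertex k) : (kaltonGraph k).dist m n ≤ 2 * k := by
  have key : ∀ (m : KaltonVertex k) (L : ℕ), (∀ i, m.enum i < L) →
      (kaltonGraph k).dist (kaltonBlock k L) m ≤ k := by
    intro m L hL
    refine kaltonGraph_dist_block_mix m.enum L hL k m ?_
    apply RelEmbedding.ext
    intro i
    rw [kaltonMix_apply, if_pos i.isLt]
  have hL : ∀ i, m.enum i < (∑ i, (m.enum i + n.enum i)) + 1 ∧
      n.enum i < (∑ i, (m.enum i + n.enum i)) + 1 := by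
    intro i
    have := Finset.single_le_sum (f := fun i => m.enum i + n.enum i) (fun _ _ => Nat.zero_le _)
      (Finset.mem_univ i)
    omega
  have h1 := key m _ fun i => (hL i).1
  have h2 := key n _ fun i => (hL i).2
  have h3 := (kaltonGraph_connected k).dist_triangle (u := m)
    (v := kaltonBlock k ((∑ i, (m.enum i + n.enum i)) + 1)) (w := n)
  rw [SimpleGraph.dist_comm] at h1
  omega

/-- Each step of a path shifts the entries of a vertex by at most one position. -/
theorem kaltonGraph_enum_le_of_walk {m n : KaltonVertex k}
    (w : (kaltonGraph k).Walk m n) : ∀ i j : Fin k, (i : ℕ) + w.length = j →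
      m.enum i ≤ n.enum j := by
  induction w with
  | nil =>
    rename_i u
    intro i j h
    exact u.enum.monotone (Fin.le_def.2 (by simpa using h.le))
  | cons hadj w ih =>
    rename_i u v x
    intro i j h
    rw [SimpleGraph.Walk.length_cons] at h
    have hi : (i : ℕ) + 1 < k := by have := j.2; omega
    refine le_trans ?_ (ih ⟨i + 1, hi⟩ j (by simp only; omega))
    rcases hadj.2 with h1 | h1
    · exact (h1.1 i).trans (v.enum.monotone (Fin.le_def.2 (by simp)))
    · exact h1.2 i ⟨i + 1, hi⟩ rfl

theorem le_kaltonGraph_dist_add {m n : KaltonVertex k} {i j : Fin k} (h : m.enum j < n.enum i) :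
    (j : ℕ) + 1 ≤ (kaltonGraph k).dist n m + i := by
  by_contra! hcon
  obtain ⟨w, hw⟩ := (kaltonGraph_connected k).exists_walk_length_eq_dist n m
  have hj : (i : ℕ) + w.length < k := by have := j.2; omega
  have h1 := kaltonGraph_enum_le_of_walk w i ⟨i + w.length, hj⟩ rfl
  have h2 : m.enum ⟨i + w.length, hj⟩ ≤ m.enum j :=
    m.enum.monotone (Fin.le_def.2 (by simp only; omega))
  exact absurd (h1.trans h2) (not_le.2 h)

end KaltonGraph

/-! ### Typical subtrees -/

section Subtrees

open Function

variable {𝕜 : Type} [RCLike 𝕜] {V : Type u} [NormedAddCommGroup V] [NormedSpace 𝕜 V]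

/-- A bounded tree of functionals of height `k`, whose nodes of level `i` are represented by
sequences of which the first `i` entries matter: the value at a node of level `i < k` is
the weak* limit along `U` of the values at its successors. -/
structure IsWeakStarTree (U : Ultrafilter ℕ) (k : ℕ) (B : ℝ)
    (Φ : ℕ → (ℕ → ℕ) → StrongDual 𝕜 V) : Prop where
  norm_le : ∀ i s, ‖Φ i s‖ ≤ B
  tendsto : ∀ i < k, ∀ s v, Tendsto (fun a => Φ (i + 1) (update s i a) v) U (𝓝 (Φ i s v))

variable {E : Type v} [NormedAddCommGroup E] [NormedSpace 𝕜 E]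

/-- A subtree `A` in which `U`-almost every successor of a node is again a node, and such that the
increments of `Φ` from level `i` to level `i + 1` have norm about `τ i` and differ from each other
by about an element of `W`, up to `ε`. -/
structure IsTypicalSubtree (U : Ultrafilter ℕ) (k : ℕ) (Φ : ℕ → (ℕ → ℕ) → E)
    (W : Submodule 𝕜 (E)) (τ : ℕ → ℝ) (ε : ℝ)
    (A : ℕ → (ℕ → ℕ) → Prop) : Prop where
  root : A 0 0
  step : ∀ i < k, ∀ s, A i s → ∀ᶠ a in U, A (i + 1) (update s i a)
  norm_close : ∀ i < k, ∀ s a, A (i + 1) (update s i a) →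
    |‖Φ (i + 1) (update s i a) - Φ i s‖ - τ i| < ε
  sub_close : ∀ i < k, ∀ s a s' a', A (i + 1) (update s i a) → A (i + 1) (update s' i a') →
    ∃ w ∈ W, ‖Φ (i + 1) (update s i a) - Φ i s - (Φ (i + 1) (update s' i a') - Φ i s') - w‖ <
      2 * ε

theorem exists_isTypicalSubtree (U : Ultrafilter ℕ) {k : ℕ} {B : ℝ}
    {Φ : ℕ → (ℕ → ℕ) → E} (hΦ : ∀ i s, ‖Φ i s‖ ≤ B)
    (hΦ' : ∀ i < k, ∀ s b, Φ i (update s i b) = Φ i s) {W : Submodule 𝕜 (E)}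
    [hWc : IsClosed (W : Set (E))] (hWf : W.CoFG) :
    ∃ τ : ℕ → ℝ, ∀ ε : ℝ, 0 < ε → ∃ A, IsTypicalSubtree U k Φ W τ ε A := by
  have : FiniteDimensional 𝕜 (E ⧸ W) := hWf
  have : ProperSpace (E ⧸ W) := FiniteDimensional.proper_rclike 𝕜 (E ⧸ W)
  let D : ℕ → (ℕ → ℕ) → ℝ × (E ⧸ W) := fun i s =>
    (‖Φ i s - Φ (i - 1) s‖, Submodule.Quotient.mk (Φ i s - Φ (i - 1) s))
  have hD : ∀ i s, D i s ∈ Metric.closedBall (0 : ℝ × (E ⧸ W)) (B + B) := by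
    intro i s
    have h : ‖Φ i s - Φ (i - 1) s‖ ≤ B + B :=
      (norm_sub_le _ _).trans (add_le_add (hΦ _ _) (hΦ _ _))
    rw [mem_closedBall_zero_iff, Prod.norm_def]
    refine max_le (by simpa [D] using h) ((Submodule.Quotient.norm_mk_le W _).trans h)
  obtain ⟨d, hd⟩ := exists_typical_subtree U (isCompact_closedBall _ _)
    Metric.isClosed_closedBall hD
  refine ⟨fun i => (d (i + 1)).1, fun ε hε => ?_⟩
  obtain ⟨A, hA0, hA1, hA2⟩ := hd k ε hε
  have h : ∀ i < k, ∀ s a, A (i + 1) (update s i a) →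
      dist (‖Φ (i + 1) (update s i a) - Φ i s‖,
        (Submodule.Quotient.mk (Φ (i + 1) (update s i a) - Φ i s) : E ⧸ W))
        (d (i + 1)) < ε := by
    intro i hi s a ha
    have := hA2 (i + 1) hi _ ha
    simpa only [D, Nat.add_sub_cancel, hΦ' i hi s a] using this
  refine ⟨A, hA0, hA1, fun i hi s a ha => ?_, fun i hi s a s' a' ha ha' => ?_⟩
  · have := h i hi s a ha
    rw [Prod.dist_eq] at this
    exact (le_max_left _ _).trans_lt this
  · have h1 := h i hi s a ha
    have h2 := h i hi s' a' ha'
    rw [Prod.dist_eq] at h1 h2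
    refine exists_mem_of_norm_mk_lt ?_
    rw [Submodule.Quotient.mk_sub, ← dist_eq_norm]
    refine (dist_triangle_right _ _ (d (i + 1)).2).trans_lt ?_
    rw [two_mul]
    exact add_lt_add ((le_max_right _ _).trans_lt h1) ((le_max_right _ _).trans_lt h2)

theorem strictMonoOn_update {s : ℕ → ℕ} {i a : ℕ} (hs : StrictMonoOn s (Set.Iio i))
    (ha : ∀ j < i, s j < a) : StrictMonoOn (update s i a) (Set.Iio (i + 1)) := by
  intro j hj j' hj' hjj
  simp only [Set.mem_Iio] at hj hj'
  rw [update_of_ne (by omega)]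
  rcases eq_or_ne j' i with rfl | h
  · rw [update_self]
    exact ha j hjj
  · rw [update_of_ne h]
    exact hs (Set.mem_Iio.2 (by omega)) (Set.mem_Iio.2 (by omega)) hjj

theorem exists_forall_lt_le (s : ℕ → ℕ) (i : ℕ) : ∃ m, ∀ j < i, s j ≤ m :=
  ⟨(Finset.range i).sup s, fun _ hj => Finset.le_sup (Finset.mem_range.2 hj)⟩

/-- `s` represents a node of level `i` of the subtree `A` whose entries increase. -/
def IsIncreasingNode (A : ℕ → (ℕ → ℕ) → Prop) (i : ℕ) (s : ℕ → ℕ) : Prop :=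
  A i s ∧ StrictMonoOn s (Set.Iio i)

variable {U : Ultrafilter ℕ} {k : ℕ} {B ε : ℝ} {Φ : ℕ → (ℕ → ℕ) → StrongDual 𝕜 V}
  {W : Submodule 𝕜 (StrongDual 𝕜 V)} {τ : ℕ → ℝ}
  {A : ℕ → (ℕ → ℕ) → Prop}

theorem IsTypicalSubtree.eventually_isIncreasingNode (hU : (U : Filter ℕ) ≤ atTop)
    (hA : IsTypicalSubtree U k Φ W τ ε A) {i : ℕ} (hi : i < k) {s : ℕ → ℕ}
    (hs : IsIncreasingNode A i s) : ∀ᶠ a in U, IsIncreasingNode A (i + 1) (update s i a) := by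
  obtain ⟨m, hm⟩ := exists_forall_lt_le s i
  filter_upwards [hA.step i hi s hs.1, hU (eventually_gt_atTop m)] with a h1 h2
  exact ⟨h1, strictMonoOn_update hs.2 fun j hj => (hm j hj).trans_lt h2⟩

theorem IsTypicalSubtree.exists_isIncreasingNode (hU : (U : Filter ℕ) ≤ atTop)
    (hA : IsTypicalSubtree U k Φ W τ ε A) {i : ℕ} (hi : i ≤ k) :
    ∃ s, IsIncreasingNode A i s := by
  induction i with
  | zero => exact ⟨0, hA.root, fun j hj => absurd hj (Nat.not_lt_zero j)⟩
  | succ i ih =>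
    obtain ⟨s, hs⟩ := ih (by omega)
    obtain ⟨a, ha⟩ := (hA.eventually_isIncreasingNode hU (by omega) hs).exists
    exact ⟨_, ha⟩

theorem IsTypicalSubtree.add_pos (hU : (U : Filter ℕ) ≤ atTop)
    (hA : IsTypicalSubtree U k Φ W τ ε A) {i : ℕ} (hi : i < k) : 0 < τ i + ε := by
  obtain ⟨s, hs⟩ := hA.exists_isIncreasingNode hU hi.le
  obtain ⟨a, ha⟩ := (hA.step i hi s hs.1).exists
  have := (abs_lt.1 (hA.norm_close i hi s a ha)).2
  linarith [norm_nonneg (Φ (i + 1) (update s i a) - Φ i s)]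

theorem IsWeakStarTree.tendsto_increment (hΦ : IsWeakStarTree U k B Φ) {i : ℕ} (hi : i < k)
    (s : ℕ → ℕ) (v : V) :
    Tendsto (fun a => (Φ (i + 1) (update s i a) - Φ i s) v) U (𝓝 0) := by
  have := (hΦ.tendsto i hi s v).sub_const (Φ i s v)
  rw [sub_self] at this
  exact this

/-- The chain of inequalities `s 0 ≤ s' 0 ≤ s 1 ≤ s' 1 ≤ ⋯ ≤ s (k - 1) ≤ s' (k - 1)`. -/
def InterlacedBelow (k : ℕ) (s s' : ℕ → ℕ) : Prop :=
  (∀ j < k, s j ≤ s' j) ∧ ∀ j, j + 1 < k → s' j ≤ s (j + 1)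

/-- If the values of a tree at interlaced nodes of the top level are at distance at most `Λ` for a
norm with lower `p`-estimates, then the typical norms of its increments are bounded in `ℓ_p`. -/
theorem IsTypicalSubtree.sum_le (hU : (U : Filter ℕ) ≤ atTop) (hΦ : IsWeakStarTree U k B Φ)
    (hA : IsTypicalSubtree U k Φ W τ ε A) {M : Seminorm 𝕜 V} {p κ Λ : ℝ} (hp : 0 < p)
    (hM : ∀ (ψ : StrongDual 𝕜 V) (g : ℕ → StrongDual 𝕜 V)
      (G t η : ℝ), (∀ n, ‖g n‖ ≤ G) → (∀ v, Tendsto (fun n => g n v) U (𝓝 0)) → 0 ≤ t →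
      (∀ᶠ n in U, t ≤ ‖g n‖) → 0 < η →
      ∀ᶠ n in U, dualNorm M ψ ^ p + κ * t ^ p - η ≤ dualNorm M (ψ + g n) ^ p)
    (hΛ : ∀ s s', StrictMonoOn s (Set.Iio k) → StrictMonoOn s' (Set.Iio k) →
      InterlacedBelow k s s' → dualNorm M (Φ k s - Φ k s') ≤ Λ) :
    κ * ∑ i ∈ Finset.range k, (max (τ i - ε) 0) ^ p ≤ Λ ^ p := by
  have hgt : ∀ m, ∀ᶠ a in (U : Filter ℕ), m < a := fun m => hU (eventually_gt_atTop m)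
  have hinc : ∀ i s a, ‖Φ (i + 1) (update s i a) - Φ i s‖ ≤ B + B := fun i s a =>
    (norm_sub_le _ _).trans (add_le_add (hΦ.norm_le _ _) (hΦ.norm_le _ _))
  have key : ∀ η : ℝ, 0 < η → ∀ i ≤ k, ∃ s s', IsIncreasingNode A i s ∧ IsIncreasingNode A i s' ∧
      InterlacedBelow i s s' ∧ κ * ∑ j ∈ Finset.range i, (max (τ j - ε) 0) ^ p - i * (2 * η) ≤
        dualNorm M (Φ i s - Φ i s') ^ p := by
    intro η hη i
    induction i with
    | zero =>
      intro _
      obtain ⟨s, hs⟩ := hA.exists_isIncreasingNode hU (Nat.zero_le k)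
      refine ⟨s, s, hs, hs, ⟨fun j hj => absurd hj (Nat.not_lt_zero j),
        fun j hj => absurd hj (Nat.not_lt_zero _)⟩, ?_⟩
      simp only [Finset.range_zero, Finset.sum_empty, mul_zero, Nat.cast_zero, zero_mul, sub_zero]
      exact Real.rpow_nonneg (dualNorm_nonneg _ _) _
    | succ i ih =>
      intro hi
      have hi : i < k := hi
      obtain ⟨s, s', hs, hs', hI, h⟩ := ih hi.le
      obtain ⟨m, hm⟩ := exists_forall_lt_le s' i
      obtain ⟨a, ha, hma, h1⟩ := ((hA.eventually_isIncreasingNode hU hi hs).and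
        ((hgt m).and (hM (Φ i s - Φ i s')
          (fun a => Φ (i + 1) (update s i a) - Φ i s) (B + B) (max (τ i - ε) 0) η
          (hinc i s) (hΦ.tendsto_increment hi s) (le_max_right _ _) (by
            filter_upwards [hA.step i hi s hs.1] with a ha
            have := (abs_lt.1 (hA.norm_close i hi s a ha)).1
            exact max_le (by linarith) (norm_nonneg _)) hη))).exists
      -- The second vertex only has to move on; its increment must not decrease the norm.
      obtain ⟨a', ha', haa, h2⟩ := ((hA.eventually_isIncreasingNode hU hi hs').and
        ((hgt a).and (hM (Φ (i + 1) (update s i a) - Φ i s')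
          (fun a => -(Φ (i + 1) (update s' i a) - Φ i s')) (B + B) 0 η
          (fun a => by rw [norm_neg]; exact hinc i s' a)
          (fun v => by simpa using (hΦ.tendsto_increment hi s' v).neg) le_rfl
          (Eventually.of_forall fun _ => norm_nonneg _) hη))).exists
      refine ⟨update s i a, update s' i a', ha, ha', ⟨fun j hj => ?_, fun j hj => ?_⟩, ?_⟩
      · rcases Nat.lt_succ_iff_lt_or_eq.1 hj with hj | rfl
        · rw [update_of_ne hj.ne, update_of_ne hj.ne]
          exact hI.1 j hj
        · simpa using haa.le
      · have hji : j < i := by omega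
        rw [update_of_ne hji.ne]
        rcases Nat.lt_succ_iff_lt_or_eq.1 hj with hj | hj
        · rw [update_of_ne hj.ne]
          exact hI.2 j hj
        · subst hj
          rw [update_self]
          exact (hm j hji).trans hma.le
      · rw [Real.zero_rpow hp.ne', mul_zero, add_zero] at h2
        have e1 : Φ i s - Φ i s' + (Φ (i + 1) (update s i a) - Φ i s) =
          Φ (i + 1) (update s i a) - Φ i s' := by abel
        have e2 : Φ (i + 1) (update s i a) - Φ i s' + -(Φ (i + 1) (update s' i a') - Φ i s') =
          Φ (i + 1) (update s i a) - Φ (i + 1) (update s' i a') := by abel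
        rw [e1] at h1
        rw [e2] at h2
        rw [Finset.sum_range_succ]
        push_cast
        linarith
  refine le_of_forall_pos_sub_le fun η hη => ?_
  obtain ⟨s, s', hs, hs', hI, h⟩ := key (η / (2 * (k + 1))) (by positivity) k le_rfl
  have h1 : (k : ℝ) * (2 * (η / (2 * (k + 1)))) ≤ η := by
    have : (k : ℝ) * (2 * (η / (2 * (k + 1)))) = η * (k / (k + 1)) := by field_simp
    rw [this]
    exact mul_le_of_le_one_right hη.le ((div_le_one (by positivity)).2 (by linarith))
  have h2 := Real.rpow_le_rpow (dualNorm_nonneg _ _) (hΛ s s' hs.2 hs'.2 hI) hp.le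
  linarith

end Subtrees

/-! ### Branches at bounded distance -/

section UpperTree

open Function

variable {𝕜 : Type} [RCLike 𝕜] {X : Type u} [NormedAddCommGroup X] [NormedSpace 𝕜 X]
  {V : Type v} [NormedAddCommGroup V] [NormedSpace 𝕜 V]

/-- `ψ` is within `Δ` of the canonical image of a vector `x` with `N x ^ p ≤ Q`. -/
def IsNearVector (J : X →ₗᵢ[𝕜] StrongDual 𝕜 V) (N : Seminorm 𝕜 X) (p Δ Q : ℝ)
    (ψ : StrongDual 𝕜 V) : Prop :=
  ∃ x, ‖ψ - J x‖ ≤ Δ ∧ N x ^ p ≤ Q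

theorem isNearVector_zero (J : X →ₗᵢ[𝕜] StrongDual 𝕜 V) (N : Seminorm 𝕜 X) {p : ℝ}
    (hp : 0 < p) : IsNearVector J N p 0 0 0 :=
  ⟨0, by simp, by simp [Real.zero_rpow hp.ne']⟩

variable {U : Ultrafilter ℕ} {N : Seminorm 𝕜 X} {p C b : ℝ}
  {J : X →ₗᵢ[𝕜] StrongDual 𝕜 V}

theorem IsNearVector.eventually_add (hJ : RepresentsDual J) (hb : 0 < b)
    (hN : ∀ x, N x ≤ b * ‖x‖) (h : HasUpperEstimate p C N) {Δ Q : ℝ}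
    {ψ : StrongDual 𝕜 V} (hψ : IsNearVector J N p Δ Q ψ)
    {g : ℕ → StrongDual 𝕜 V} (hg : ∀ φ, Tendsto (fun n => g n φ) U (𝓝 0))
    {t δ : ℝ} (ht0 : 0 ≤ t) (hδ : 0 < δ) (ht : ∀ᶠ n in U, ‖g n‖ ≤ t)
    (hgδ : ∀ᶠ n in U, ∃ z, ‖g n - J z‖ < δ) :
    ∀ᶠ n in U, IsNearVector J N p (Δ + 3 * δ) (Q + C * b ^ p * (t + 3 * δ) ^ p) (ψ + g n) := by
  obtain ⟨x, hx, hxQ⟩ := hψ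
  filter_upwards [eventually_exists_upper_estimate hJ hb hN h x hg ht0 hδ ht hgδ] with n hn
  obtain ⟨y, hy, hyx⟩ := hn
  refine ⟨x + y, ?_, by linarith⟩
  have e : ψ + g n - J (x + y) = (ψ - J x) + (g n - J y) := by rw [map_add]; abel
  rw [e]
  exact (norm_add_le (ψ - J x) (g n - J y)).trans (add_le_add hx hy)

/-- In a typical subtree there are two branches which agree except on the levels from `i₀` to
`i₀ + l`, where all entries of the first one precede those of the second one, and such that the
difference of the values of the tree is controlled by the upper estimates of `X`. -/
theorem IsTypicalSubtree.exists_shifted_branches {k : ℕ} {B ε : ℝ} {τ : ℕ → ℝ}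
    {Φ : ℕ → (ℕ → ℕ) → StrongDual 𝕜 V}
    {A : ℕ → (ℕ → ℕ) → Prop} (hU : (U : Filter ℕ) ≤ atTop) (hΦ : IsWeakStarTree U k B Φ)
    (hA : IsTypicalSubtree U k Φ (LinearMap.range J.toLinearMap) τ ε A) (hε : 0 < ε)
    (hJ : RepresentsDual J) (hp : 0 < p) (hb : 0 < b) (hN : ∀ x, N x ≤ b * ‖x‖) (hC : 0 < C)
    (h : HasUpperEstimate p C N) (hτ : ∀ i < k, 0 ≤ τ i) {i₀ l : ℕ} (hl : 0 < l)
    (hk : i₀ + l ≤ k) :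
    ∃ s s' : ℕ → ℕ, StrictMonoOn s (Set.Iio k) ∧ StrictMonoOn s' (Set.Iio k) ∧
      s (i₀ + l - 1) < s' i₀ ∧
      IsNearVector J N p (6 * ∑ j ∈ Finset.range l, (τ (i₀ + j) + ε) + k * (6 * ε))
        (2 * (C * b ^ p * ∑ i ∈ Finset.range k, (8 * (τ i + ε)) ^ p)) (Φ k s - Φ k s') := by
  have hgt : ∀ m, ∀ᶠ a in (U : Filter ℕ), m < a := fun m => hU (eventually_gt_atTop m)
  have hCb : 0 < C * b ^ p := by positivity
  set c : ℕ → ℝ := fun i => C * b ^ p * (8 * (τ i + ε)) ^ p with hc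
  have hc0 : ∀ i < k, 0 ≤ c i := fun i hi => by
    have := hτ i hi
    simp only [hc]
    positivity
  -- Adding an increment to one of the two branches.
  have hone : ∀ {i : ℕ}, i < k → ∀ {s : ℕ → ℕ}, IsIncreasingNode A i s →
      ∀ {Δ Q : ℝ} {ψ : StrongDual 𝕜 V}, IsNearVector J N p Δ Q ψ →
      ∀ (σ : 𝕜), ‖σ‖ = 1 → ∀ᶠ a in U,
        IsNearVector J N p (Δ + 3 * (τ i + ε)) (Q + c i)
          (ψ + σ • (Φ (i + 1) (update s i a) - Φ i s)) := by
    intro i hi s hs Δ Q ψ hψ σ hσ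
    have hpos := hA.add_pos hU hi
    have hn : ∀ᶠ a in U, ‖σ • (Φ (i + 1) (update s i a) - Φ i s)‖ < τ i + ε := by
      filter_upwards [hA.step i hi s hs.1] with a ha
      rw [norm_smul, hσ, one_mul]
      linarith [(abs_lt.1 (hA.norm_close i hi s a ha)).2]
    filter_upwards [hψ.eventually_add hJ hb hN h
      (g := fun a => σ • (Φ (i + 1) (update s i a) - Φ i s)) (fun v => by
        simpa using (hΦ.tendsto_increment hi s v).const_mul σ) hpos.le hpos
      (hn.mono fun _ => le_of_lt) (hn.mono fun a ha => ⟨0, by simpa using ha⟩)] with a ha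
    obtain ⟨x, hx, hxQ⟩ := ha
    refine ⟨x, hx, hxQ.trans ?_⟩
    simp only [hc]
    have : (τ i + ε + 3 * (τ i + ε)) ^ p ≤ (8 * (τ i + ε)) ^ p :=
      Real.rpow_le_rpow (by positivity) (by linarith) hp.le
    gcongr
  -- The two branches split at level `i₀`; the first one is prolonged.
  obtain ⟨s₀, hs₀⟩ := hA.exists_isIncreasingNode hU (show i₀ ≤ k by omega)
  have hfirst : ∀ j ≤ l, ∃ s, IsIncreasingNode A (i₀ + j) s ∧
      IsNearVector J N p (∑ m ∈ Finset.range j, 3 * (τ (i₀ + m) + ε))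
        (∑ m ∈ Finset.range j, c (i₀ + m)) (Φ (i₀ + j) s - Φ i₀ s₀) := by
    intro j
    induction j with
    | zero => exact fun _ => ⟨s₀, hs₀, by simpa using isNearVector_zero J N hp⟩
    | succ j ih =>
      intro hj
      obtain ⟨s, hs, hsn⟩ := ih (by omega)
      have hi : i₀ + j < k := by omega
      obtain ⟨a, ha, han⟩ := ((hA.eventually_isIncreasingNode hU hi hs).and
        (hone hi hs hsn 1 norm_one)).exists
      refine ⟨_, ha, ?_⟩
      rw [Finset.sum_range_succ, Finset.sum_range_succ]
      convert han using 1
      rw [one_smul, ← add_assoc i₀ j 1]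
      abel
  obtain ⟨s₁, hs₁, hs₁n⟩ := hfirst l le_rfl
  -- The second branch is prolonged beyond the first one.
  have hsecond : ∀ j ≤ l, ∃ s, IsIncreasingNode A (i₀ + j) s ∧
      (0 < j → s₁ (i₀ + l - 1) < s i₀) ∧
      IsNearVector J N p (∑ m ∈ Finset.range l, 3 * (τ (i₀ + m) + ε) +
          ∑ m ∈ Finset.range j, 3 * (τ (i₀ + m) + ε))
        (∑ m ∈ Finset.range l, c (i₀ + m) + ∑ m ∈ Finset.range j, c (i₀ + m))
        (Φ (i₀ + l) s₁ - Φ (i₀ + j) s) := by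
    intro j
    induction j with
    | zero => exact fun _ => ⟨s₀, hs₀, fun h => absurd h (lt_irrefl 0), by simpa using hs₁n⟩
    | succ j ih =>
      intro hj
      obtain ⟨s, hs, hlt, hsn⟩ := ih (by omega)
      have hi : i₀ + j < k := by omega
      obtain ⟨a, ha, hsa, han⟩ := ((hA.eventually_isIncreasingNode hU hi hs).and
        ((hgt (s₁ (i₀ + l - 1))).and (hone hi hs hsn (-1) (by simp)))).exists
      refine ⟨_, ha, fun _ => ?_, ?_⟩
      · rcases Nat.eq_zero_or_pos j with rfl | hj0
        · simpa using hsa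
        · rw [update_of_ne (by omega)]
          exact hlt hj0
      · rw [Finset.sum_range_succ _ j, Finset.sum_range_succ _ j, ← add_assoc, ← add_assoc]
        convert han using 1
        rw [← add_assoc i₀ j 1]
        module
  obtain ⟨s₂, hs₂, hlt, hs₂n⟩ := hsecond l le_rfl
  -- Afterwards both branches continue with the same entries.
  have hthird : ∀ j, i₀ + l + j ≤ k → ∃ s s', IsIncreasingNode A (i₀ + l + j) s ∧
      IsIncreasingNode A (i₀ + l + j) s' ∧ s (i₀ + l - 1) < s' i₀ ∧
      IsNearVector J N p (∑ m ∈ Finset.range l, 3 * (τ (i₀ + m) + ε) +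
          ∑ m ∈ Finset.range l, 3 * (τ (i₀ + m) + ε) + j * (6 * ε))
        (∑ m ∈ Finset.range l, c (i₀ + m) + ∑ m ∈ Finset.range l, c (i₀ + m) +
          ∑ m ∈ Finset.range j, c (i₀ + l + m))
        (Φ (i₀ + l + j) s - Φ (i₀ + l + j) s') := by
    intro j
    induction j with
    | zero => exact fun _ => ⟨s₁, s₂, hs₁, hs₂, hlt hl, by simpa using hs₂n⟩
    | succ j ih =>
      intro hj
      obtain ⟨s, s', hs, hs', hlt, hsn⟩ := ih (by omega)
      set i := i₀ + l + j with hidef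
      have hi : i < k := by omega
      have hτi := hτ i hi
      have hn : ∀ᶠ a in U, ‖(Φ (i + 1) (update s i a) - Φ i s) -
          (Φ (i + 1) (update s' i a) - Φ i s')‖ ≤ 2 * (τ i + ε) := by
        filter_upwards [hA.step i hi s hs.1, hA.step i hi s' hs'.1] with a h1 h2
        linarith [(abs_lt.1 (hA.norm_close i hi s a h1)).2,
          (abs_lt.1 (hA.norm_close i hi s' a h2)).2,
          norm_sub_le (Φ (i + 1) (update s i a) - Φ i s) (Φ (i + 1) (update s' i a) - Φ i s')]
      have hd : ∀ᶠ a in U, ∃ z, ‖(Φ (i + 1) (update s i a) - Φ i s) -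
          (Φ (i + 1) (update s' i a) - Φ i s') - J z‖ < 2 * ε := by
        filter_upwards [hA.step i hi s hs.1, hA.step i hi s' hs'.1] with a h1 h2
        obtain ⟨_, ⟨z, rfl⟩, hz⟩ := hA.sub_close i hi s a s' a h1 h2
        exact ⟨z, hz⟩
      have hadd := hsn.eventually_add hJ hb hN h (U := U)
        (g := fun a => (Φ (i + 1) (update s i a) - Φ i s) -
          (Φ (i + 1) (update s' i a) - Φ i s')) (fun v => by
            simpa using (hΦ.tendsto_increment hi s v).sub (hΦ.tendsto_increment hi s' v))
        (by positivity) (by positivity : 0 < 2 * ε) hn hd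
      obtain ⟨a, ha, ha', han⟩ := ((hA.eventually_isIncreasingNode hU hi hs).and
        ((hA.eventually_isIncreasingNode hU hi hs').and hadd)).exists
      refine ⟨_, _, ha, ha', ?_, ?_⟩
      · rwa [update_of_ne (by omega), update_of_ne (by omega)]
      · obtain ⟨x, hx, hxQ⟩ := han
        refine ⟨x, ?_, hxQ.trans ?_⟩
        · have e1 : Φ (i + 1) (update s i a) - Φ (i + 1) (update s' i a) - J x =
              Φ i s - Φ i s' + (Φ (i + 1) (update s i a) - Φ i s -
              (Φ (i + 1) (update s' i a) - Φ i s')) - J x := by abel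
          rw [show i₀ + l + (j + 1) = i + 1 by omega, e1]
          refine hx.trans (le_of_eq ?_)
          push_cast
          ring
        · rw [Finset.sum_range_succ, ← add_assoc]
          simp only [hc]
          have : (2 * (τ i + ε) + 3 * (2 * ε)) ^ p ≤ (8 * (τ i + ε)) ^ p :=
            Real.rpow_le_rpow (by positivity) (by linarith) hp.le
          gcongr
  obtain ⟨s, s', hs, hs', hlt, x, hx, hxQ⟩ := hthird (k - (i₀ + l)) (by omega)
  have hkk : i₀ + l + (k - (i₀ + l)) = k := by omega
  rw [hkk] at hs hs' hx
  refine ⟨s, s', hs.2, hs'.2, hlt, x, hx.trans ?_, hxQ.trans ?_⟩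
  · rw [← Finset.mul_sum]
    have : ((k - (i₀ + l) : ℕ) : ℝ) * (6 * ε) ≤ k * (6 * ε) := by
      gcongr
      omega
    linarith
  · have h1 : ∑ i ∈ Finset.range k, c i = ∑ i ∈ Finset.range i₀, c i +
        ∑ m ∈ Finset.range l, c (i₀ + m) + ∑ m ∈ Finset.range (k - (i₀ + l)), c (i₀ + l + m) := by
      rw [← Finset.sum_range_add, ← Finset.sum_range_add, hkk]
    have h2 : 0 ≤ ∑ i ∈ Finset.range i₀, c i :=
      Finset.sum_nonneg fun i hi => hc0 i (by have := Finset.mem_range.1 hi; omega)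
    have h3 : 0 ≤ ∑ m ∈ Finset.range (k - (i₀ + l)), c (i₀ + l + m) :=
      Finset.sum_nonneg fun i hi => hc0 _ (by have := Finset.mem_range.1 hi; omega)
    rw [Finset.mul_sum]
    linarith

end UpperTree

/-! ### Kalton's graphs do not embed -/

section Core

variable {𝕜 : Type} [RCLike 𝕜] {X : Type u} [NormedAddCommGroup X] [NormedSpace 𝕜 X]
  {V : Type v} [NormedAddCommGroup V] [NormedSpace 𝕜 V]

/-- Among sufficiently many consecutive blocks of length `l`, some block carries only a small part
of a bounded sum of nonnegative terms. -/
theorem exists_block_sum_le {l n : ℕ} {x : ℕ → ℝ} {S : ℝ}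
    (hS : ∑ i ∈ Finset.range (n * l), x i ≤ S) (hn : 0 < n) :
    ∃ m < n, n * ∑ j ∈ Finset.range l, x (m * l + j) ≤ S := by
  have hsum : ∑ i ∈ Finset.range (n * l), x i =
      ∑ m ∈ Finset.range n, ∑ j ∈ Finset.range l, x (m * l + j) := by
    clear hS hn
    induction n with
    | zero => simp
    | succ n ih => rw [Nat.succ_mul, Finset.sum_range_add, ih, Finset.sum_range_succ]
  by_contra! hcon
  have h1 : ∑ m ∈ Finset.range n, S / n <
      ∑ m ∈ Finset.range n, ∑ j ∈ Finset.range l, x (m * l + j) := by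
    refine Finset.sum_lt_sum_of_nonempty (Finset.nonempty_range_iff.2 hn.ne') fun m hm => ?_
    rw [div_lt_iff₀' (by positivity)]
    exact hcon m (Finset.mem_range.1 hm)
  rw [Finset.sum_const, Finset.card_range, nsmul_eq_mul, mul_div_cancel₀ _ (by positivity)] at h1
  linarith

/-- The vertex of Kalton's graph listed by a sequence which increases below `k`. -/
def vertexOf (k : ℕ) (s : ℕ → ℕ) (hs : StrictMonoOn s (Set.Iio k)) : KaltonVertex k :=
  OrderEmbedding.ofStrictMono (fun i : Fin k => s i) fun i j h =>
    hs (Set.mem_Iio.2 i.2) (Set.mem_Iio.2 j.2) h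

theorem vertexOf_enum {k : ℕ} {s : ℕ → ℕ} (hs : StrictMonoOn s (Set.Iio k)) (i : Fin k) :
    (vertexOf k s hs).enum i = s i := rfl

/-- If `X` embeds with finite codimension into the dual of `V`, if `X` has upper `p`-estimates and
the dual of `V` lower ones, then maps from Kalton's graphs to `X` that are Lipschitz with a fixed
constant send some pairs of far apart vertices to pairs at bounded distance. -/
theorem exists_far_vertices_norm_sub_le {J : X →ₗᵢ[𝕜] StrongDual 𝕜 V} (hJ : RepresentsDual J)
    (hJc : IsClosed (LinearMap.range J.toLinearMap : Set (StrongDual 𝕜 V)))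
    (hJf : (LinearMap.range J.toLinearMap).CoFG) {N : Seminorm 𝕜 X} (hN : IsEquivalentNorm N)
    {M : Seminorm 𝕜 V} (hM : IsEquivalentNorm M) {p q C C' : ℝ} (hpq : p.HolderConjugate q)
    (hC : 0 < C) (hNC : HasUpperEstimate p C N) (hC' : 0 < C') (hMC : HasUpperEstimate q C' M)
    {ω : ℝ} (hω : 0 ≤ ω) :
    ∃ R : ℝ, ∀ l : ℕ, 0 < l → ∃ k : ℕ, 0 < k ∧ ∀ f : KaltonVertex k → X,
      (∃ B, ∀ v w, ‖f v - f w‖ ≤ B) →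
      (∀ v w, (kaltonGraph k).dist v w ≤ 1 → ‖f v - f w‖ ≤ ω) →
      ∃ v w, l ≤ (kaltonGraph k).dist v w ∧ ‖f v - f w‖ ≤ R := by
  have hp : 0 < p := hpq.pos
  obtain ⟨aN, bN, haN, hbN, hNab⟩ := hN
  obtain ⟨κ, hκ, hlow⟩ := exists_dualNorm_lower_estimate hM hpq hC' hMC
  obtain ⟨aM, bM, haM, hbM, hMab⟩ := hM
  obtain ⟨U, hU⟩ : ∃ U : Ultrafilter ℕ, (U : Filter ℕ) ≤ atTop :=
    ⟨hyperfilter ℕ, by rw [← Nat.cofinite_eq_atTop]; exact hyperfilter_le_cofinite⟩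
  -- The bound for the typical increments, which does not depend on the height of the tree.
  set S : ℝ := (ω / aM) ^ p / κ with hS
  have hS0 : 0 ≤ S := by positivity
  set Q : ℝ := 2 * (C * bN ^ p * (8 ^ p * (S + 1))) with hQ
  have hQ0 : 0 ≤ Q := by positivity
  refine ⟨18 + Q ^ (1 / p) / aN, fun l hl => ?_⟩
  obtain ⟨n, hn⟩ := exists_nat_ge (S * (l : ℝ) ^ p)
  set k : ℕ := (n + 1) * l with hk
  have hk0 : 0 < k := by positivity
  refine ⟨k, hk0, fun f ⟨D, hD⟩ hf => ?_⟩
  -- The map as a function on sequences, with values in the dual of `V`.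
  classical
  let F : (ℕ → ℕ) → StrongDual 𝕜 V := fun s =>
    if hs : StrictMonoOn s (Set.Iio k) then J (f (vertexOf k s hs)) else 0
  have hF : ∀ {s} (hs : StrictMonoOn s (Set.Iio k)), F s = J (f (vertexOf k s hs)) :=
    fun hs => dif_pos hs
  have hFB : ∀ s, ‖F s‖ ≤ ‖f (kaltonBlock k 0)‖ + D := by
    intro s
    have hD0 : 0 ≤ D := (norm_nonneg _).trans (hD (kaltonBlock k 0) (kaltonBlock k 0))
    by_cases hs : StrictMonoOn s (Set.Iio k)
    · rw [hF hs, J.norm_map]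
      linarith [norm_le_norm_add_norm_sub' (f (vertexOf k s hs)) (f (kaltonBlock k 0)),
        hD (vertexOf k s hs) (kaltonBlock k 0)]
    · simp only [F, dif_neg hs, norm_zero]
      positivity
  obtain ⟨Φ, hΦk, hΦB, hΦ⟩ := exists_weakStar_tree U k F hFB
  have htree : IsWeakStarTree U k (‖f (kaltonBlock k 0)‖ + D) Φ :=
    ⟨hΦB, fun i hi s => (hΦ i hi s).1⟩
  obtain ⟨τ, hτ⟩ := exists_isTypicalSubtree U hΦB (fun i hi s => (hΦ i hi s).2) (hWc := hJc) hJf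
  have hτ0 : ∀ i < k, 0 ≤ τ i := by
    intro i hi
    refine le_of_forall_pos_le_add fun ε hε => ?_
    obtain ⟨A, hA⟩ := hτ ε hε
    exact (hA.add_pos hU hi).le
  have hΛ : ∀ s s', StrictMonoOn s (Set.Iio k) → StrictMonoOn s' (Set.Iio k) →
      InterlacedBelow k s s' → dualNorm M (Φ k s - Φ k s') ≤ ω / aM := by
    intro s s' hs hs' hI
    refine (dualNorm_le haM (fun v => (hMab v).1) _).trans ?_
    rw [hΦk, hF hs, hF hs', ← map_sub, J.norm_map]
    gcongr
    refine hf _ _ (kaltonGraph_dist_le_one ⟨fun i => hI.1 i i.2, fun i j hij => ?_⟩)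
    rw [vertexOf_enum, vertexOf_enum, ← hij]
    exact hI.2 i (by have := j.2; omega)
  have hsum : ∑ i ∈ Finset.range k, τ i ^ p ≤ S := by
    have hcont : Continuous fun ε : ℝ => ∑ i ∈ Finset.range k, (max (τ i - ε) 0) ^ p :=
      continuous_finsetSum _ fun i _ =>
        ((continuous_const.sub continuous_id).max continuous_const).rpow_const
          fun _ => Or.inr hp.le
    have h1 := (hcont.tendsto 0).mono_left (nhdsWithin_le_nhds (s := Set.Ioi 0))
    have h2 : ∑ i ∈ Finset.range k, (max (τ i - 0) 0) ^ p = ∑ i ∈ Finset.range k, τ i ^ p :=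
      Finset.sum_congr rfl fun i hi => by
        rw [sub_zero, max_eq_left (hτ0 i (Finset.mem_range.1 hi))]
    rw [h2] at h1
    refine le_of_tendsto h1 ?_
    filter_upwards [self_mem_nhdsWithin] with ε hε
    obtain ⟨A, hA⟩ := hτ ε hε
    rw [hS, le_div_iff₀' hκ]
    exact hA.sum_le hU htree hp (hlow U) hΛ
  -- A block of levels on which the typical increments are at most `1 / l`.
  obtain ⟨m, hm, hblock⟩ := exists_block_sum_le (x := fun i => τ i ^ p) (S := S) hsum
    (Nat.succ_pos n)
  have hml : m * l + l ≤ k := by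
    rw [hk, ← Nat.succ_mul]
    exact Nat.mul_le_mul_right l hm
  have hτl : ∀ j < l, τ (m * l + j) ≤ 1 / l := by
    intro j hj
    have hj0 := hτ0 (m * l + j) (by omega)
    have h1 : τ (m * l + j) ^ p ≤ ∑ j ∈ Finset.range l, τ (m * l + j) ^ p :=
      Finset.single_le_sum (f := fun j => τ (m * l + j) ^ p)
        (fun i hi => Real.rpow_nonneg (hτ0 _ (by have := Finset.mem_range.1 hi; omega)) _)
        (Finset.mem_range.2 hj)
    have h2 : ((n + 1 : ℕ) : ℝ) * τ (m * l + j) ^ p ≤ S :=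
      (mul_le_mul_of_nonneg_left h1 (by positivity)).trans hblock
    have hl0 : (0 : ℝ) < l := by exact_mod_cast hl
    rw [le_div_iff₀ hl0]
    by_contra! hcon
    have h3 := Real.one_lt_rpow hcon hp
    rw [Real.mul_rpow hj0 hl0.le] at h3
    have h4 : 0 ≤ τ (m * l + j) ^ p := by positivity
    have h5 : 0 < (l : ℝ) ^ p := by positivity
    have h6 : ((n + 1 : ℕ) : ℝ) * (τ (m * l + j) ^ p * (l : ℝ) ^ p) ≤ n := by
      calc _ = ((n + 1 : ℕ) : ℝ) * τ (m * l + j) ^ p * (l : ℝ) ^ p := by ring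
        _ ≤ S * (l : ℝ) ^ p := by gcongr
        _ ≤ n := hn
    push_cast at h6
    nlinarith
  -- An approximation for which all errors together are bounded.
  obtain ⟨ε, ⟨hε1, hε2⟩, hε⟩ : ∃ ε : ℝ, (∑ i ∈ Finset.range k, (τ i + ε) ^ p ≤ S + 1 ∧
      k * (6 * ε) ≤ 6) ∧ ε ∈ Set.Ioi (0 : ℝ) := by
    have hcont : Continuous fun ε : ℝ => ∑ i ∈ Finset.range k, (τ i + ε) ^ p :=
      continuous_finsetSum _ fun i _ =>
        (continuous_const.add continuous_id).rpow_const fun _ => Or.inr hp.le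
    have h1 := (hcont.tendsto 0).mono_left (nhdsWithin_le_nhds (s := Set.Ioi 0))
    simp only [add_zero] at h1
    have hcont2 : Continuous fun ε : ℝ => (k : ℝ) * (6 * ε) := by fun_prop
    have h2 := (hcont2.tendsto 0).mono_left (nhdsWithin_le_nhds (s := Set.Ioi 0))
    simp only [mul_zero] at h2
    exact (((h1.eventually_le_const (by linarith)).and
      (h2.eventually_le_const (by norm_num))).and self_mem_nhdsWithin).exists
  have hε : 0 < ε := hε
  obtain ⟨A, hA⟩ := hτ ε hε
  obtain ⟨s, s', hs, hs', hlt, x, hx, hxQ⟩ := hA.exists_shifted_branches hU htree hε hJ hp hbN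
    (fun x => (hNab x).2) hC hNC hτ0 hl hml
  refine ⟨vertexOf k s' hs', vertexOf k s hs, ?_, ?_⟩
  · have h1 := le_kaltonGraph_dist_add (m := vertexOf k s hs) (n := vertexOf k s' hs')
      (i := ⟨m * l, by omega⟩) (j := ⟨m * l + l - 1, by omega⟩) hlt
    simp only at h1
    omega
  · rw [norm_sub_rev, ← J.norm_map, map_sub, ← hF hs, ← hF hs', ← hΦk]
    have h1 : 6 * ∑ j ∈ Finset.range l, (τ (m * l + j) + ε) + k * (6 * ε) ≤ 18 := by
      have h2 : ∑ j ∈ Finset.range l, (τ (m * l + j) + ε) ≤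
          ∑ j ∈ Finset.range l, (1 / (l : ℝ) + ε) :=
        Finset.sum_le_sum fun j hj => by linarith [hτl j (Finset.mem_range.1 hj)]
      rw [Finset.sum_const, Finset.card_range, nsmul_eq_mul, mul_add,
        mul_one_div_cancel (by positivity)] at h2
      have h3 : (l : ℝ) * ε ≤ k * ε := by
        gcongr
        omega
      linarith
    have h2 : N x ^ p ≤ Q := by
      refine hxQ.trans ?_
      rw [hQ]
      have h3 : ∑ i ∈ Finset.range k, (8 * (τ i + ε)) ^ p =
          8 ^ p * ∑ i ∈ Finset.range k, (τ i + ε) ^ p := by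
        rw [Finset.mul_sum]
        refine Finset.sum_congr rfl fun i hi => Real.mul_rpow (by norm_num) ?_
        linarith [hτ0 i (Finset.mem_range.1 hi)]
      rw [h3]
      gcongr
    have h3 : N x ≤ Q ^ (1 / p) := by
      rw [one_div]
      exact (Real.le_rpow_inv_iff_of_pos (apply_nonneg _ _) hQ0 hp).2 h2
    have h4 : ‖x‖ ≤ Q ^ (1 / p) / aN := by
      rw [le_div_iff₀' haN]
      exact (hNab x).1.trans h3
    have h5 := norm_le_norm_add_norm_sub' (Φ k s - Φ k s') (J x)
    rw [J.norm_map] at h5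
    linarith

/-- The range of `J` has finite codimension. -/
def HasCofiniteRange (𝕜 : Type) [RCLike 𝕜] {X : Type u} [NormedAddCommGroup X]
    [NormedSpace 𝕜 X] {Z : Type v} [NormedAddCommGroup Z] [NormedSpace 𝕜 Z]
    (J : X →ₗᵢ[𝕜] Z) : Prop :=
  (LinearMap.range J.toLinearMap).CoFG

/-- A space satisfying the assumptions of `exists_far_vertices_norm_sub_le` does not contain
Kalton's graphs equi-coarsely. -/
theorem not_equiCoarselyEmbeds_of_hasUpperEstimate {J : X →ₗᵢ[𝕜] StrongDual 𝕜 V}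
    (hJ : RepresentsDual J)
    (hJc : IsClosed (LinearMap.range J.toLinearMap : Set (StrongDual 𝕜 V)))
    (hJf : HasCofiniteRange 𝕜 J) {N : Seminorm 𝕜 X} (hN : IsEquivalentNorm N)
    {M : Seminorm 𝕜 V} (hM : IsEquivalentNorm M) {p q C C' : ℝ} (hpq : p.HolderConjugate q)
    (hC : 0 < C) (hNC : HasUpperEstimate p C N) (hC' : 0 < C') (hMC : HasUpperEstimate q C' M) :
    ¬ EquiCoarselyEmbeds (fun k : ℕ+ => KaltonVertex k) X := by
  rintro ⟨ρ, ω, f, hρ, hf⟩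
  obtain ⟨R, hR⟩ := exists_far_vertices_norm_sub_le hJ hJc hJf hN hM hpq hC hNC hC' hMC
    (ω 1).coe_nonneg
  have hexp : ∀ (k : ℕ+) (t : ℕ) (v w : KaltonVertex k), (kaltonGraph k).dist v w ≤ t →
      ‖f k v - f k w‖ ≤ ω t := by
    intro k t v w h
    have h1 : nndist v w ≤ (t : ℝ≥0) := by
      rw [← NNReal.coe_le_coe, coe_nndist]
      exact Nat.cast_le.2 h
    have h2 : edist (f k v) (f k w) ≤ ω t :=
      (le_iSup₂_of_le v w
        (le_iSup (fun _ : nndist v w ≤ (t : ℝ≥0) => edist (f k v) (f k w)) h1)).trans (hf k t).2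
    rw [edist_nndist, ENNReal.coe_le_coe, ← NNReal.coe_le_coe, coe_nndist, dist_eq_norm] at h2
    exact h2
  have hcomp : ∀ (k : ℕ+) (t : ℕ) (v w : KaltonVertex k), t ≤ (kaltonGraph k).dist v w →
      (ρ t : ℝ) ≤ ‖f k v - f k w‖ := by
    intro k t v w h
    have h1 : (t : ℝ≥0) ≤ nndist v w := by
      rw [← NNReal.coe_le_coe, coe_nndist]
      exact Nat.cast_le.2 h
    have h2 : (ρ t : ℝ≥0∞) ≤ edist (f k v) (f k w) :=
      (hf k t).1.trans (iInf₂_le_of_le v w (iInf_le_of_le h1 le_rfl))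
    rw [edist_nndist, ENNReal.coe_le_coe, ← NNReal.coe_le_coe, coe_nndist, dist_eq_norm] at h2
    exact h2
  have hρ' : Tendsto (fun l : ℕ => ρ (l : ℝ≥0)) atTop atTop :=
    hρ.comp tendsto_natCast_atTop_atTop
  obtain ⟨l, hl, hl0⟩ := ((hρ'.eventually_gt_atTop R.toNNReal).and (eventually_gt_atTop 0)).exists
  obtain ⟨k, hk, hfk⟩ := hR l hl0
  obtain ⟨v, w, hvw, h⟩ := hfk (f ⟨k, hk⟩)
    ⟨ω (2 * k : ℕ), fun v w => hexp ⟨k, hk⟩ (2 * k) v w (kaltonGraph_dist_le v w)⟩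
    fun v w hvw => by simpa using hexp ⟨k, hk⟩ 1 v w hvw
  have h1 := hcomp ⟨k, hk⟩ l v w hvw
  have h2 : R < ρ l := (Real.le_coe_toNNReal R).trans_lt (NNReal.coe_lt_coe.2 hl)
  linarith

end Core

/-! ### Passing to duals -/

section Duals

variable {𝕜 : Type} [RCLike 𝕜] {X : Type u} [NormedAddCommGroup X] [NormedSpace 𝕜 X]
  {Z : Type v} [NormedAddCommGroup Z] [NormedSpace 𝕜 Z]

variable (𝕜) in
/-- The dual of `X`, with the module structure of its argument taken from the normed space
structure. -/
abbrev NormedDual (X : Type u) [NormedAddCommGroup X] [NormedSpace 𝕜 X] : Type u :=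
  StrongDual 𝕜 X

variable (𝕜) in
/-- Linear isometries between normed spaces, with the module structures taken from the normed space
structures. -/
abbrev IsometricEmbedding (X : Type u) (Z : Type v) [NormedAddCommGroup X] [NormedSpace 𝕜 X]
    [NormedAddCommGroup Z] [NormedSpace 𝕜 Z] : Type (max u v) :=
  X →ₗᵢ[𝕜] Z

variable (𝕜 X) in
/-- The canonical embedding into the bidual, typed so that its module structures agree
syntactically with those of statements about general normed spaces. -/
noncomputable def bidualEmbedding : IsometricEmbedding 𝕜 X (NormedDual 𝕜 (NormedDual 𝕜 X)) :=
  NormedSpace.inclusionInDoubleDualLi 𝕜 (E := X)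

theorem representsDual_bidualEmbedding :
    RepresentsDual (V := NormedDual 𝕜 X) (bidualEmbedding 𝕜 X) :=
  fun φ => ⟨φ, le_rfl, fun _ => rfl⟩

theorem isClosed_range_linearIsometry [CompleteSpace X] (J : X →ₗᵢ[𝕜] Z) :
    IsClosed (LinearMap.range J.toLinearMap : Set Z) := by
  rw [LinearMap.coe_range]
  exact J.isometry.isClosedEmbedding.isClosed_range

/-- Asymptotic smoothness passes from a complete subspace of finite codimension to the whole space:
take the maximum of the given norm of the component in the subspace and of the norm of the
component in a finite-dimensional complement. -/
theorem AdmitsEquivalentPAUSNorm.of_linearIsometry [CompleteSpace X] (J : X →ₗᵢ[𝕜] Z)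
    (hJ : HasCofiniteRange 𝕜 J) {p : ℝ} (hp : 1 < p)
    (h : AdmitsEquivalentPAUSNorm 𝕜 X p) : AdmitsEquivalentPAUSNorm 𝕜 Z p := by
  have hp0 : 0 < p := by linarith
  obtain ⟨N, ⟨a, b, ha, hb, hab⟩, hN⟩ := h
  obtain ⟨C, hC, hNC⟩ := hN.exists_hasUpperEstimate hp
  have : FiniteDimensional 𝕜 (Z ⧸ LinearMap.range J.toLinearMap) := hJ
  obtain ⟨f, hf⟩ := Submodule.ClosedComplemented.of_finiteDimensional_quotient
    (isClosed_range_linearIsometry J)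
  -- `P` is a projection onto `X`, and `R` the complementary projection of `Z`.
  let P : Z →L[𝕜] X := (J.equivRange.symm : LinearMap.range J.toLinearMap →L[𝕜] X).comp f
  have hP : ∀ x, P (J x) = x := by
    intro x
    have h1 : f (J x) = J.equivRange x := hf ⟨J x, x, rfl⟩
    simp only [P, ContinuousLinearMap.comp_apply, h1]
    exact J.equivRange.symm_apply_apply x
  let R : Z →L[𝕜] Z := ContinuousLinearMap.id 𝕜 Z - J.toContinuousLinearMap.comp P
  have hR : ∀ z, R z = z - J (P z) := fun _ => rfl
  let N' : Seminorm 𝕜 Z := N.comp (P : Z →ₗ[𝕜] X) ⊔ (normSeminorm 𝕜 Z).comp (R : Z →ₗ[𝕜] Z)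
  have hN' : ∀ z, N' z = max (N (P z)) ‖R z‖ := fun _ => rfl
  refine ⟨N', ⟨1 / (1 / a + 1), b * ‖P‖ + ‖R‖ + 1, by positivity, by positivity,
    fun z => ⟨?_, ?_⟩⟩, C, hC, fun t ht => ?_⟩
  · rw [one_div_mul_eq_div, div_le_iff₀ (by positivity), hN']
    have h1 : ‖z‖ ≤ ‖P z‖ + ‖R z‖ := by
      rw [← J.norm_map (P z), hR]
      exact norm_le_norm_add_norm_sub' z _
    have h2 : ‖P z‖ ≤ N (P z) * (1 / a) := by
      rw [mul_one_div, le_div_iff₀' ha]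
      exact (hab _).1
    have h3 : N (P z) * (1 / a) ≤ max (N (P z)) ‖R z‖ * (1 / a) := by
      gcongr
      exact le_max_left _ _
    linarith [le_max_right (N (P z)) ‖R z‖]
  · rw [hN']
    have h1 : N (P z) ≤ b * (‖P‖ * ‖z‖) := (hab _).2.trans (by gcongr; exact P.le_opNorm z)
    have h2 := R.le_opNorm z
    have h3 : 0 ≤ b * (‖P‖ * ‖z‖) := by positivity
    have h4 : 0 ≤ ‖R‖ * ‖z‖ := by positivity
    have h5 := norm_nonneg z
    exact max_le (by linarith) (by linarith)
  · refine iSup₂_le fun z hz => ?_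
    obtain ⟨Y, hYc, hYf, hY⟩ := hNC.exists_of_nonneg hp0 (P z) ht
    have h1 : IsClosed ((Y.comap (P : Z →ₗ[𝕜] X) ⊓ LinearMap.ker (R : Z →ₗ[𝕜] Z) :
        Submodule 𝕜 Z) : Set Z) := (hYc.preimage P.continuous).inter R.isClosed_ker
    have h2 : (Y.comap (P : Z →ₗ[𝕜] X) ⊓ LinearMap.ker (R : Z →ₗ[𝕜] Z)).CoFG := by
      refine Submodule.CoFG.inf ?_ ?_
      · have : FiniteDimensional 𝕜 (X ⧸ Y) := hYf
        have h3 := Submodule.CoFG.ker (Y.mkQ.comp (P : Z →ₗ[𝕜] X))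
        rwa [LinearMap.ker_comp, Submodule.ker_mkQ] at h3
      · refine Submodule.CoFG.of_le (fun z hz => ?_) hJ
        obtain ⟨x, rfl⟩ := hz
        change R (J x) = 0
        rw [hR, hP, sub_self]
    refine iInf_le_of_le _ (iInf_le_of_le h1 (iInf_le_of_le h2 (iSup₂_le fun y hy => ?_)))
    obtain ⟨⟨hyY, hyR⟩, hy1⟩ := hy
    have hyR : R y = 0 := hyR
    have hP1 : P (z + (t : 𝕜) • y) = P z + (t : 𝕜) • P y := by rw [map_add, map_smul]
    have hR1 : R (z + (t : 𝕜) • y) = R z := by rw [map_add, map_smul, hyR, smul_zero, add_zero]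
    rw [EReal.coe_le_coe_iff, sub_le_iff_le_add', hN', hP1, hR1]
    have hPz : N (P z) ≤ 1 := hz ▸ hN' z ▸ le_max_left _ _
    have hRz : ‖R z‖ ≤ 1 := hz ▸ hN' z ▸ le_max_right _ _
    have hPy : N (P y) ≤ 1 := hy1 ▸ hN' y ▸ le_max_left _ _
    have hCt : 0 ≤ C * t ^ p := by positivity
    refine max_le ?_ (by linarith)
    have h3 := hY ((t : 𝕜) • P y) (Y.smul_mem _ hyY) (by
      rw [map_smul_eq_mul, RCLike.norm_ofReal, abs_of_nonneg ht]
      exact mul_le_of_le_one_right ht hPy)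
    have h4 : N (P z) ^ p ≤ 1 := Real.rpow_le_one (apply_nonneg _ _) hPz hp0.le
    have h5 : (1 + C * t ^ p) ≤ (1 + C * t ^ p) ^ p :=
      Real.self_le_rpow_of_one_le (by linarith) hp.le
    exact (Real.rpow_le_rpow_iff (apply_nonneg _ _) (by positivity) hp0).1 (by linarith)

/-- If the range of `J : X → Z` has finite codimension and `J'` is a right inverse of the
transpose of `J`, then the range of `J'` has finite codimension. -/
theorem HasCofiniteRange.of_dual_rightInverse (J : X →ₗᵢ[𝕜] Z)
    (hJ : HasCofiniteRange 𝕜 J)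
    (J' : StrongDual 𝕜 X →ₗᵢ[𝕜] StrongDual 𝕜 Z) (h : ∀ φ x, J' φ (J x) = φ x) :
    HasCofiniteRange 𝕜 J' := by
  have : FiniteDimensional 𝕜 (Z ⧸ LinearMap.range J.toLinearMap) := hJ
  -- `T Ψ` is the functional induced on the quotient by the part of `Ψ` vanishing on `J X`.
  let T : StrongDual 𝕜 Z →ₗ[𝕜] Module.Dual 𝕜 (Z ⧸ LinearMap.range J.toLinearMap) :=
    { toFun := fun Ψ => (LinearMap.range J.toLinearMap).liftQ
        ((Ψ - J' (Ψ.comp J.toContinuousLinearMap) : StrongDual 𝕜 Z) : Z →ₗ[𝕜] 𝕜) (by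
          rintro _ ⟨x, rfl⟩
          simp [h])
      map_add' := fun Ψ Ψ' => by
        ext z
        simp
        ring
      map_smul' := fun c Ψ => by
        ext z
        simp
        ring }
  refine Submodule.CoFG.of_le (fun Ψ hΨ => ⟨Ψ.comp J.toContinuousLinearMap, ?_⟩)
    (Submodule.CoFG.ker T)
  ext z
  have h1 := LinearMap.congr_fun (LinearMap.mem_ker.1 hΨ) (Submodule.Quotient.mk z)
  exact (sub_eq_zero.1 h1).symm

theorem IsQuasiReflexive.hasCofiniteRange (h : IsQuasiReflexive 𝕜 X) :
    HasCofiniteRange 𝕜 (bidualEmbedding 𝕜 X) :=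
  h

theorem IsQuasiReflexive.dual (h : IsQuasiReflexive 𝕜 X) :
    IsQuasiReflexive 𝕜 (StrongDual 𝕜 X) :=
  h.hasCofiniteRange.of_dual_rightInverse _
    (bidualEmbedding 𝕜 (NormedDual 𝕜 X))
    fun _ _ => rfl

/-- A complete quasi-reflexive space `X` with an equivalent `p`-AUS norm, such that `X*` has an
equivalent `q`-AUS norm. -/
structure HasSmoothDuality (𝕜 : Type) [RCLike 𝕜] (X : Type u) [NormedAddCommGroup X]
    [NormedSpace 𝕜 X] (p q : ℝ) : Prop where
  complete : CompleteSpace X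
  quasiReflexive : IsQuasiReflexive 𝕜 X
  paus : AdmitsEquivalentPAUSNorm 𝕜 X p
  dual_paus : AdmitsEquivalentPAUSNorm 𝕜 (StrongDual 𝕜 X) q

theorem HasSmoothDuality.dual {p q : ℝ} (hp : 1 < p) (h : HasSmoothDuality 𝕜 X p q) :
    HasSmoothDuality 𝕜 (StrongDual 𝕜 X) q p where
  complete := inferInstance
  quasiReflexive := h.quasiReflexive.dual
  paus := h.dual_paus
  dual_paus := by
    have := h.complete
    exact h.paus.of_linearIsometry (bidualEmbedding 𝕜 X)
      h.quasiReflexive.hasCofiniteRange hp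

theorem HasSmoothDuality.not_equiCoarselyEmbeds {p q : ℝ} (hpq : p.HolderConjugate q)
    (h : HasSmoothDuality 𝕜 X p q) :
    ¬ EquiCoarselyEmbeds (fun k : ℕ+ => KaltonVertex k) X := by
  have := h.complete
  obtain ⟨N, hN, hNp⟩ := h.paus
  obtain ⟨M, hM, hMq⟩ := h.dual_paus
  obtain ⟨C, hC, hNC⟩ := hNp.exists_hasUpperEstimate hpq.lt
  obtain ⟨C', hC', hMC⟩ := hMq.exists_hasUpperEstimate hpq.symm.lt
  exact not_equiCoarselyEmbeds_of_hasUpperEstimate representsDual_bidualEmbedding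
    (isClosed_range_linearIsometry _) h.quasiReflexive.hasCofiniteRange hN hM hpq hC hNC hC' hMC

theorem HasSmoothDuality.iteratedDual {p q : ℝ} (hpq : p.HolderConjugate q)
    (h : HasSmoothDuality 𝕜 X p q) (r : ℕ) : ∃ p' q' : ℝ, p'.HolderConjugate q' ∧
      HasSmoothDuality 𝕜 (IteratedDual 𝕜 X r) p' q' := by
  induction r with
  | zero => exact ⟨p, q, hpq, h⟩
  | succ r ih =>
    obtain ⟨p', q', hpq', h'⟩ := ih
    exact ⟨q', p', hpq'.symm, h'.dual hpq'.lt⟩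

end Duals

theorem corollary4p2 {𝕜 : Type} [RCLike 𝕜] {X : Type u} [NormedAddCommGroup X] [NormedSpace 𝕜 X]
    [CompleteSpace X] (hX : IsQuasiReflexive 𝕜 X) (p q : ℝ) (hp : 1 < p)
    (hpq : p.HolderConjugate q) (hXp : AdmitsEquivalentPAUSNorm 𝕜 X p)
    (hXq : AdmitsEquivalentPAUSNorm 𝕜 (StrongDual 𝕜 X) q) :
    ¬ EquiCoarselyEmbeds (fun k : ℕ+ => KaltonVertex k) X ∧
      ∀ r : ℕ, ¬ EquiCoarselyEmbeds (fun k : ℕ+ => KaltonVertex k) (IteratedDual 𝕜 X r) := by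
  have h : HasSmoothDuality 𝕜 X p q := ⟨inferInstance, hX, hXp, hXq⟩
  refine ⟨h.not_equiCoarselyEmbeds hpq, fun r => ?_⟩
  obtain ⟨p', q', hpq', h'⟩ := h.iteratedDual hpq r
  exact h'.not_equiCoarselyEmbeds hpq'
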